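/- There exist universal constants $C_1,C_2>0$ such that the following holds. Let $G=(V,E)$ be one of the following graphs. (1D) $V=\{1,\dots,n\}$, and distinct $i,j$ are joined by an edge iff $|i-j|\le r$, where $r$ is an integer with $1\le r\le n$. (2D) $n=m^2$, $V=\{1,\dots,m\}^2$, and distinct $i=(i_1,i_2)$, $j=(j_1,j_2)$ are joined by an edge iff $|i_1-j_1|+|i_2-j_2|\le r$, where $r$ is an integer with $1\le r\le 2m$. Nodes are ordered lexicographically. Let $\theta^\star\in\mathbb R^V$ satisfy $\sum_{i\in V}\theta^\star_i=0$, and let $\kappa_E\ge 1$ be such that $|\theta^\star_i-\theta^\star_j|\le\log\kappa_E$ for all $(i,j)\in E$. For every edge $(i,j)\in E$ with $i<j$ one observes $L\ge 1$ samples $y_{i,j}^{(1)},\dots,y_{i,j}^{(L)}$; all samples on all edges are independent, and $\mathbb P(y_{i,j}^{(\ell)}=1)=1-\mathbb P(y_{i,j}^{(\ell)}=0)=1/(1+e^{-(\theta^\star_i-\theta^\star_j)})$. A maximum likelihood estimate (MLE) is a minimizer, over all $\theta\in\mathbb R^V$ with $\sum_{i\in V}\theta_i=0$, of $$\mathcal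 L(\theta)=\sum_{(i,j)\in E,\ i<j}\ \sum_{\ell=1}^{L}\Big(-y_{i,j}^{(\ell)}(\theta_i-\theta_j)+\log\big(1+e^{\theta_i-\theta_j}\big)\Big).$$ Let $0<\delta<1$, and suppose that $$rL\ \ge\ C_1\,\kappa_E^5\, n\log(n/\delta)\ \text{ in case (1D)},\qquad r^2L\ \ge\ C_1\,\kappa_E^5\, n\log(n/\delta)\ \text{ in case (2D)}.$$ Then, with probability at least $1-\delta$, a (finite) MLE $\theta^{\mathsf{MLE}}$ exists and is unique, and it satisfies, for all $k,l\in V$, $$\big|(\theta^{\mathsf{MLE}}_k-\theta^{\mathsf{MLE}}_l)-(\theta^\star_k-\theta^\star_l)\big|\ \le\ \begin{cases}C_2\,\kappa_E\sqrt{\big(\tfrac{n}{r^2}+1\big)\tfrac{1}{rL}\log\tfrac n\delta} & \text{in case (1D)},\\[4pt] C_2\,\kappa_E\sqrt{\big(\tfrac{\log n}{r^2}+1\big)\tfrac{1}{r^2L}\log\tfrac n\delta} & \text{in case (2D)}.\end{cases}$$ -/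

import Mathlib

open MeasureTheory ProbabilityTheory

namespace BTL

/-- The one-dimensional grid with `n` nodes and radius `r` (edge probability one): two distinct
nodes are adjacent exactly when their positions differ by at most `r`. -/
def grid1D (n r : ℕ) : SimpleGraph (Fin n) where
  Adj i j := i ≠ j ∧ |(i.val : ℤ) - (j.val : ℤ)| ≤ (r : ℤ)
  symm := ⟨fun i j h => ⟨h.1.symm, by rw [abs_sub_comm]; exact h.2⟩⟩
  loopless := ⟨fun i h => h.1 rfl⟩

/-- The two-dimensional `m × m` grid (so `n = m ^ 2` nodes) with radius `r` (edge probability one):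
two distinct nodes are adjacent exactly when their `ℓ₁` distance is at most `r`. The nodes carry the
lexicographic order, which serves only to orient every edge once. -/
def grid2D (m r : ℕ) : SimpleGraph (Fin m ×ₗ Fin m) where
  Adj i j := i ≠ j ∧
    |((ofLex i).1.val : ℤ) - ((ofLex j).1.val : ℤ)|
      + |((ofLex i).2.val : ℤ) - ((ofLex j).2.val : ℤ)| ≤ (r : ℤ)
  symm := ⟨fun i j h => ⟨h.1.symm, by
    rw [abs_sub_comm ((ofLex j).1.val : ℤ), abs_sub_comm ((ofLex j).2.val : ℤ)]; exact h.2⟩⟩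
  loopless := ⟨fun i h => h.1 rfl⟩

section Model

variable {V : Type*} [LinearOrder V]

/-- The edges `(i, j)` of `G`, each listed once, with `i < j`. -/
abbrev OrientedEdge (G : SimpleGraph V) : Type _ :=
  {e : V × V // G.Adj e.1 e.2 ∧ e.1 < e.2}

/-- `y e l`, for `e = (i, j)` an edge with `i < j` and `l < L`, are independent Bernoulli samples
with `P (y e l = 1) = σ (θ i - θ j) = 1 - P (y e l = 0)`: the data of the Bradley-Terry-Luce model
with score vector `θ` and `L` comparisons on each edge of `G`. -/
structure IsSample {Ω : Type*} [MeasurableSpace Ω] (P : Measure Ω) (G : SimpleGraph V)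
    (L : ℕ) (θ : V → ℝ) (y : OrientedEdge G → Fin L → Ω → ℝ) : Prop where
  measurable : ∀ e l, Measurable (y e l)
  prob_one : ∀ e l, P {ω | y e l ω = 1} = ENNReal.ofReal (Real.sigmoid (θ e.1.1 - θ e.1.2))
  prob_zero : ∀ e l, P {ω | y e l ω = 0} = ENNReal.ofReal (1 - Real.sigmoid (θ e.1.1 - θ e.1.2))
  indep : iIndepFun (fun x : OrientedEdge G × Fin L => y x.1 x.2) P

variable [Fintype V]

open scoped Classical in
/-- The negative log-likelihood of the score vector `θ`, given the observed outcomes `y`. -/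
noncomputable def loss (G : SimpleGraph V) (L : ℕ) (y : OrientedEdge G → Fin L → ℝ)
    (θ : V → ℝ) : ℝ :=
  ∑ e : OrientedEdge G, ∑ l : Fin L,
    (-(y e l) * (θ e.1.1 - θ e.1.2) + Real.log (1 + Real.exp (θ e.1.1 - θ e.1.2)))

/-- `θ` is a (finite) minimizer of the negative log-likelihood over all real score vectors whose
entries sum to zero, i.e. a maximum likelihood estimate. -/
def IsMLE (G : SimpleGraph V) (L : ℕ) (y : OrientedEdge G → Fin L → ℝ) (θ : V → ℝ) : Prop :=
  ∑ i, θ i = 0 ∧ IsMinOn (loss G L y) {θ' : V → ℝ | ∑ i, θ' i = 0} θ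

end Model

end BTL

/-!
The logistic loss is strictly convex, so its minimizer is its only critical point. To locate that
point, take Newton steps with the Hessian frozen at `θ⋆`, a graph Laplacian whose edge weights are
at least `L / (4 κ)`. The first step, started from `θ⋆`, is the linearised estimate; every other
step lands near the same place, up to a quadratic Taylor remainder. Hence the steps preserve the
neighbourhood of `θ⋆` on which all edge differences are correct up to twice the noise level. The
loss has a minimizer on this compact neighbourhood, and since the steps are descent directions, it
must be a fixed point, that is, a critical point.

The linearised error at `(k, l)` is a combination of the independent centred comparisons, with
coefficients given by the potential of a unit current from `k` to `l`. The energy of this potential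
is controlled by the effective resistance between `k` and `l`, so Hoeffding's inequality bounds the
error by a multiple of the square root of the resistance.

The resistances are bounded by averaging over blocks of side comparable to `r`: this compares the
graph with a path or with a square lattice. The resistance of a path is its length. That of the
square lattice is logarithmic, because a unit current can leave a corner through growing
antidiagonals, the `d`-th of which contributes about `1 / d`.
-/

namespace BTL

section Logistic

/-- The variance of a Bernoulli variable of mean `Real.sigmoid x`; it is also the derivative of
`Real.sigmoid` at `x`, hence the Fisher information of one comparison. -/
noncomputable def sigmoidVar (x : ℝ) : ℝ := Real.sigmoid x * (1 - Real.sigmoid x)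

lemma sigmoidVar_pos (x : ℝ) : 0 < sigmoidVar x :=
  mul_pos (Real.sigmoid_pos x) (sub_pos.2 (Real.sigmoid_lt_one x))

lemma sigmoidVar_neg (x : ℝ) : sigmoidVar (-x) = sigmoidVar x := by
  rw [sigmoidVar, sigmoidVar, Real.sigmoid_neg]
  ring

lemma abs_sigmoid_sub_le (a b : ℝ) : |Real.sigmoid b - Real.sigmoid a| ≤ |b - a| := by
  have deriv_le : ∀ x ∈ Set.univ, ‖sigmoidVar x‖ ≤ 1 := fun x _ => by
    rw [Real.norm_eq_abs, abs_of_pos (sigmoidVar_pos x), sigmoidVar]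
    nlinarith [Real.sigmoid_pos x, Real.sigmoid_lt_one x]
  simpa using convex_univ.norm_image_sub_le_of_norm_hasDerivWithin_le
    (fun x _ => (Real.hasDerivAt_sigmoid x).hasDerivWithinAt) deriv_le
    (Set.mem_univ a) (Set.mem_univ b)

lemma abs_sigmoidVar_sub_le (a b : ℝ) : |sigmoidVar b - sigmoidVar a| ≤ |b - a| := by
  have factored : sigmoidVar b - sigmoidVar a =
      (Real.sigmoid b - Real.sigmoid a) * (1 - Real.sigmoid b - Real.sigmoid a) := by
    rw [sigmoidVar, sigmoidVar]
    ring
  have second_factor : |1 - Real.sigmoid b - Real.sigmoid a| ≤ 1 := abs_le.2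
    ⟨by linarith [Real.sigmoid_lt_one a, Real.sigmoid_lt_one b],
      by linarith [Real.sigmoid_pos a, Real.sigmoid_pos b]⟩
  rw [factored, abs_mul]
  exact (mul_le_of_le_one_right (abs_nonneg _) second_factor).trans (abs_sigmoid_sub_le a b)

lemma abs_sigmoid_sub_linear_le (a b : ℝ) :
    |Real.sigmoid b - Real.sigmoid a - sigmoidVar a * (b - a)| ≤ (b - a) ^ 2 := by
  have h := (convex_closedBall a |b - a|).norm_image_sub_le_of_norm_hasDerivWithin_le
    (f := fun x => Real.sigmoid x - sigmoidVar a * x) (f' := fun x => sigmoidVar x - sigmoidVar a)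
    (C := |b - a|) (x := a) (y := b)
    (fun x _ => ((Real.hasDerivAt_sigmoid x).sub
      (by simpa using (hasDerivAt_id x).const_mul _)).hasDerivWithinAt)
    (fun x hx => (abs_sigmoidVar_sub_le a x).trans (mem_closedBall_iff_norm.1 hx))
    (by simp) (by simp [Real.dist_eq])
  calc |Real.sigmoid b - Real.sigmoid a - sigmoidVar a * (b - a)|
      = |(Real.sigmoid b - sigmoidVar a * b) - (Real.sigmoid a - sigmoidVar a * a)| := by ring_nf
    _ ≤ |b - a| * |b - a| := h
    _ = (b - a) ^ 2 := by rw [← sq, sq_abs]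

lemma inv_four_mul_le_sigmoidVar {a κ : ℝ} (hκ : 0 < κ) (ha : |a| ≤ Real.log κ) :
    (4 * κ)⁻¹ ≤ sigmoidVar a := by
  wlog h : 0 ≤ a generalizing a
  · simpa only [sigmoidVar_neg] using this (a := -a) (by rwa [abs_neg]) (by linarith)
  have half_le : (2 : ℝ)⁻¹ ≤ Real.sigmoid a := Real.sigmoid_zero ▸ Real.sigmoid_le h
  have inv_le : κ⁻¹ ≤ Real.exp (-a) := by
    rw [Real.exp_neg]
    exact inv_anti₀ (Real.exp_pos _)
      ((Real.le_log_iff_exp_le hκ).1 ((le_abs_self a).trans ha))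
  rw [sigmoidVar, ← Real.sigmoid_neg, ← Real.sigmoid_mul_rexp_neg]
  calc (4 * κ)⁻¹ = 2⁻¹ * (2⁻¹ * κ⁻¹) := by rw [mul_inv]; ring
    _ ≤ Real.sigmoid a * (Real.sigmoid a * Real.exp (-a)) := by gcongr

/-- The softplus function, the log-partition function of the Bernoulli family. -/
noncomputable def softplus (x : ℝ) : ℝ := Real.log (1 + Real.exp x)

lemma hasDerivAt_softplus (x : ℝ) : HasDerivAt softplus (Real.sigmoid x) x := by
  have h := ((Real.hasDerivAt_exp x).const_add 1).log (by positivity)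
  have sigmoid_eq : Real.exp x / (1 + Real.exp x) = Real.sigmoid x := by
    rw [Real.sigmoid_def, Real.exp_neg]
    field_simp
    ring
  rwa [sigmoid_eq] at h

lemma strictConvexOn_softplus : StrictConvexOn ℝ Set.univ softplus := by
  have deriv_eq : deriv softplus = Real.sigmoid := funext fun x => (hasDerivAt_softplus x).deriv
  refine StrictMono.strictConvexOn_univ_of_deriv
    (continuous_iff_continuousAt.2 fun x => (hasDerivAt_softplus x).continuousAt) ?_
  rw [deriv_eq]
  exact Real.sigmoid_strictMono

lemma softplus_tangent_lt {a b : ℝ} (hab : a ≠ b) :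
    softplus a + Real.sigmoid a * (b - a) < softplus b := by
  rcases hab.lt_or_gt with h | h
  · have := strictConvexOn_softplus.lt_slope_of_hasDerivAt
      (Set.mem_univ a) (Set.mem_univ b) h (hasDerivAt_softplus a)
    rw [slope_def_field, lt_div_iff₀ (sub_pos.2 h)] at this
    linarith
  · have := strictConvexOn_softplus.slope_lt_of_hasDerivAt
      (Set.mem_univ b) (Set.mem_univ a) h (hasDerivAt_softplus a)
    rw [slope_def_field, div_lt_iff₀ (sub_pos.2 h)] at this
    linarith

lemma softplus_tangent_le (a b : ℝ) :
    softplus a + Real.sigmoid a * (b - a) ≤ softplus b := by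
  rcases eq_or_ne a b with rfl | h
  · simp
  · exact (softplus_tangent_lt h).le

end Logistic

lemma exists_mem_fixedPoint_of_descent {U : Type*} [NormedAddCommGroup U] [NormedSpace ℝ U]
    {S : Set U} (hne : S.Nonempty) (hcomp : IsCompact S) (hconv : Convex ℝ S) {f : U → ℝ}
    {f' : U → U →L[ℝ] ℝ} (hf : ∀ x, HasFDerivAt f (f' x) x) {Φ : U → U} (hΦ : Set.MapsTo Φ S S)
    (hdesc : ∀ x, Φ x ≠ x → f' x (Φ x - x) < 0) :
    ∃ x ∈ S, Φ x = x := by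
  obtain ⟨x, hxS, hmin⟩ :=
    hcomp.exists_isMinOn hne fun x _ => (hf x).continuousAt.continuousWithinAt
  refine ⟨x, hxS, by_contra fun hne => (hdesc x hne).not_ge ?_⟩
  exact hmin.localize.hasFDerivWithinAt_nonneg (hf x).hasFDerivWithinAt
    (sub_mem_posTangentConeAt_of_segment_subset (hconv.segment_subset hxS (hΦ hxS)))

section Energy

variable {U ι : Type*} [Fintype ι] [NormedAddCommGroup U] [NormedSpace ℝ U]

/-- The energy `∑ e, (B x e) ^ 2`. When `B` takes differences along the edges of a graph, this is
the Dirichlet energy of the potential `x`, all edges having unit conductance. -/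
def energy (B : U →L[ℝ] ι → ℝ) (x : U) : ℝ := ∑ e, B x e ^ 2

lemma energy_nonneg (B : U →L[ℝ] ι → ℝ) (x : U) : 0 ≤ energy B x :=
  Finset.sum_nonneg fun _ _ => sq_nonneg _

/-- The bilinear form `∑ e, w e * B x e * B v e`. When `B` takes differences along the edges of a
graph, this is the form of the graph Laplacian with edge weights `w`. -/
noncomputable def gram (B : U →L[ℝ] ι → ℝ) (w : ι → ℝ) : LinearMap.BilinForm ℝ U :=
  ∑ e, w e • LinearMap.BilinForm.linMulLin (LinearMap.proj e ∘ₗ B.toLinearMap)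
    (LinearMap.proj e ∘ₗ B.toLinearMap)

variable {B : U →L[ℝ] ι → ℝ} {w : ι → ℝ}

lemma gram_apply (x v : U) : gram B w x v = ∑ e, w e * (B x e * B v e) := by
  simp [gram]

lemma gram_comm (x v : U) : gram B w x v = gram B w v x := by
  simp only [gram_apply, mul_comm (B x _)]

lemma mul_energy_le_gram_self {c : ℝ} (hw : ∀ e, c ≤ w e) (x : U) :
    c * energy B x ≤ gram B w x x := by
  rw [energy, gram_apply, Finset.mul_sum]
  refine Finset.sum_le_sum fun e _ => ?_
  rw [← sq]
  exact mul_le_mul_of_nonneg_right (hw e) (sq_nonneg _)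

lemma gram_self_pos (hB : Function.Injective B) (hw : ∀ e, 0 < w e) {x : U} (hx : x ≠ 0) :
    0 < gram B w x x := by
  obtain ⟨e, he⟩ : ∃ e, B x e ≠ 0 := Function.ne_iff.1 (fun h => hx (hB (h.trans B.map_zero.symm)))
  rw [gram_apply]
  exact Finset.sum_pos' (fun e _ => mul_nonneg (hw e).le (mul_self_nonneg _))
    ⟨e, Finset.mem_univ e, mul_pos (hw e) (mul_self_pos.2 he)⟩

lemma exists_gram_eq [FiniteDimensional ℝ U] (hB : Function.Injective B) (hw : ∀ e, 0 < w e)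
    (φ : Module.Dual ℝ U) : ∃ x, ∀ v, gram B w x v = φ v := by
  have ker_eq_bot : LinearMap.ker (gram B w) = ⊥ := LinearMap.ker_eq_bot'.2 fun x hx =>
    by_contra fun hx0 => (gram_self_pos hB hw hx0).ne' (by rw [hx, LinearMap.zero_apply])
  obtain ⟨x, hx⟩ := (LinearMap.injective_iff_surjective_of_finrank_eq_finrank
    Subspace.dual_finrank_eq.symm).1 (LinearMap.ker_eq_bot.1 ker_eq_bot) φ
  exact ⟨x, fun v => by rw [hx]⟩

lemma sq_mul_energy_le_of_gram_eq {c ρ : ℝ} (hc : 0 ≤ c) (hw : ∀ e, c ≤ w e) (hρ : 0 ≤ ρ)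
    {φ : U → ℝ} (hφ : ∀ x, φ x ^ 2 ≤ ρ * energy B x) {g : U} (hg : ∀ v, gram B w g v = φ v) :
    c ^ 2 * energy B g ≤ ρ := by
  rcases (energy_nonneg B g).eq_or_lt with h | h
  · rwa [← h, mul_zero]
  have sq_le : (c * energy B g) ^ 2 ≤ ρ * energy B g :=
    (pow_le_pow_left₀ (mul_nonneg hc h.le)
      ((mul_energy_le_gram_self hw g).trans_eq (hg g)) 2).trans (hφ g)
  exact le_of_mul_le_mul_right (by linarith) h

lemma sq_sum_mul_le_energy {f : ι → ℝ} {M : ℝ} (hf : ∀ e, |f e| ≤ M) (x : U) :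
    (∑ e, f e * B x e) ^ 2 ≤ Fintype.card ι * M ^ 2 * energy B x := by
  refine (Finset.sum_mul_sq_le_sq_mul_sq _ _ _).trans
    (mul_le_mul_of_nonneg_right ?_ (energy_nonneg B x))
  calc ∑ e, f e ^ 2 ≤ ∑ _e : ι, M ^ 2 := Finset.sum_le_sum fun e _ =>
        sq_le_sq' (abs_le.1 (hf e)).1 (abs_le.1 (hf e)).2
    _ = Fintype.card ι * M ^ 2 := by simp

end Energy

section LogisticRegression

variable {U ι : Type*} [Fintype ι] [NormedAddCommGroup U] [NormedSpace ℝ U]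
  {B : U →L[ℝ] ι → ℝ} {m : ℝ} {Y : ι → ℝ}

/-- The negative log-likelihood of logistic regression with predictors `B θ e`, when `Y e` of the
`m` trials at `e` are successful. -/
noncomputable def logisticLoss (B : U →L[ℝ] ι → ℝ) (m : ℝ) (Y : ι → ℝ) (θ : U) : ℝ :=
  ∑ e, (m * softplus (B θ e) - Y e * B θ e)

/-- The derivative of `logisticLoss`. -/
noncomputable def logisticScore (B : U →L[ℝ] ι → ℝ) (m : ℝ) (Y : ι → ℝ) (θ : U) : U →L[ℝ] ℝ :=
  ∑ e, (m * Real.sigmoid (B θ e) - Y e) • ContinuousLinearMap.proj e ∘L B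

lemma logisticScore_apply (θ v : U) :
    logisticScore B m Y θ v = ∑ e, (m * Real.sigmoid (B θ e) - Y e) * B v e := by
  simp [logisticScore]

lemma hasFDerivAt_logisticLoss (θ : U) :
    HasFDerivAt (logisticLoss B m Y) (logisticScore B m Y θ) θ := by
  refine HasFDerivAt.fun_sum fun e _ => ?_
  have predictor : HasFDerivAt (fun θ => B θ e) (ContinuousLinearMap.proj e ∘L B) θ :=
    (ContinuousLinearMap.proj (R := ℝ) (φ := fun _ : ι => ℝ) e ∘L B).hasFDerivAt
  have := (((hasDerivAt_softplus _).comp_hasFDerivAt θ predictor).const_mul m).fun_sub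
    (predictor.const_mul (Y e))
  rwa [smul_smul, ← sub_smul] at this

lemma logisticLoss_lt_of_logisticScore_eq_zero (hB : Function.Injective B) (hm : 0 < m) {θ θ' : U}
    (hθ : logisticScore B m Y θ = 0) (hne : θ' ≠ θ) :
    logisticLoss B m Y θ < logisticLoss B m Y θ' := by
  obtain ⟨e₀, he₀⟩ : ∃ e, B θ e ≠ B θ' e := Function.ne_iff.1 (hB.ne hne.symm)
  have stationary : ∑ e, (m * Real.sigmoid (B θ e) - Y e) * (B θ' e - B θ e) = 0 := by
    simpa [logisticScore_apply] using congr($hθ (θ' - θ))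
  have tangent : ∑ e, (m * softplus (B θ e) - Y e * B θ e +
      (m * Real.sigmoid (B θ e) - Y e) * (B θ' e - B θ e)) < logisticLoss B m Y θ' :=
    Finset.sum_lt_sum
      (fun e _ => by
        linarith [mul_le_mul_of_nonneg_left (softplus_tangent_le (B θ e) (B θ' e)) hm.le])
      ⟨e₀, Finset.mem_univ e₀, by linarith [mul_lt_mul_of_pos_left (softplus_tangent_lt he₀) hm]⟩
  rwa [Finset.sum_add_distrib, stationary, add_zero] at tangent

variable [FiniteDimensional ℝ U] {θs p : U} {κ : ℝ}

/-- One Newton step from `θ` with the Hessian frozen at `θs`. It lands at `θs + p`, up to the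
quadratic Taylor remainder of the score. -/
lemma exists_newton_step (hB : Function.Injective B) (hm : 0 < m) (hκ : 0 < κ)
    (hstar : ∀ e, |B θs e| ≤ Real.log κ)
    (hp : ∀ v, gram B (fun e => m * sigmoidVar (B θs e)) p v = -logisticScore B m Y θs v) (θ : U) :
    ∃ θ', (∀ v, gram B (fun e => m * sigmoidVar (B θs e)) (θ' - θ) v = -logisticScore B m Y θ v) ∧
      ∀ r, (∀ e, |B (θ - θs) e| ≤ r) →
        energy B (θ' - θs - p) ≤ 16 * κ ^ 2 * Fintype.card ι * r ^ 4 := by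
  set w : ι → ℝ := fun e => m * sigmoidVar (B θs e) with hw
  set rem : ι → ℝ := fun e => m * (Real.sigmoid (B θ e) - Real.sigmoid (B θs e) -
    sigmoidVar (B θs e) * (B θ e - B θs e)) with hrem
  obtain ⟨q, hq⟩ := exists_gram_eq hB (fun e => mul_pos hm (sigmoidVar_pos (B θs e)))
    (∑ e, rem e • (LinearMap.proj e ∘ₗ B.toLinearMap))
  replace hq : ∀ v, gram B w q v = ∑ e, rem e * B v e := fun v => by simp [hw, hq]
  refine ⟨θs + p - q, fun v => ?_, fun r hr => ?_⟩
  · have expansion : logisticScore B m Y θ v =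
        logisticScore B m Y θs v + gram B w (θ - θs) v + gram B w q v := by
      rw [hq, logisticScore_apply, logisticScore_apply, gram_apply, ← Finset.sum_add_distrib,
        ← Finset.sum_add_distrib]
      refine Finset.sum_congr rfl fun e _ => ?_
      rw [map_sub, Pi.sub_apply]
      ring
    rw [show θs + p - q - θ = p - (θ - θs) - q by abel]
    simp only [map_sub, LinearMap.sub_apply, hp] at expansion ⊢
    linarith
  · have rem_le : ∀ e, |-rem e| ≤ m * r ^ 2 := fun e => by
      rw [abs_neg, hrem, abs_mul, abs_of_pos hm]
      refine mul_le_mul_of_nonneg_left ((abs_sigmoid_sub_linear_le _ _).trans ?_) hm.le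
      have := hr e
      rw [map_sub, Pi.sub_apply] at this
      exact sq_le_sq' (abs_le.1 this).1 (abs_le.1 this).2
    have hw_ge : ∀ e, m * (4 * κ)⁻¹ ≤ w e := fun e =>
      mul_le_mul_of_nonneg_left (inv_four_mul_le_sigmoidVar hκ (hstar e)) hm.le
    have h := sq_mul_energy_le_of_gram_eq (B := B) (by positivity) hw_ge (by positivity)
      (sq_sum_mul_le_energy rem_le) (g := -q) fun v => by
        simp only [map_neg, LinearMap.neg_apply, hq, neg_mul, Finset.sum_neg_distrib]
    rw [show θs + p - q - θs - p = -q by abel]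
    rw [mul_inv, mul_pow] at h
    field_simp at h
    linarith

/-- The frozen Newton step is a descent direction, so the minimizer of the loss over an invariant
neighbourhood of `θs` is fixed by it, even if it lies on the boundary. -/
lemma exists_fixedPoint_logisticScore_eq_zero (hB : Function.Injective B) {w : ι → ℝ}
    (hw : ∀ e, 0 < w e) {r : ℝ} (hr : 0 ≤ r) {Φ : U → U}
    (hΦ : ∀ θ v, gram B w (Φ θ - θ) v = -logisticScore B m Y θ v)
    (hmaps : Set.MapsTo Φ (B ⁻¹' Metric.closedBall (B θs) r) (B ⁻¹' Metric.closedBall (B θs) r)) :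
    ∃ θ ∈ B ⁻¹' Metric.closedBall (B θs) r, Φ θ = θ ∧ logisticScore B m Y θ = 0 := by
  have descent : ∀ θ, Φ θ ≠ θ → logisticScore B m Y θ (Φ θ - θ) < 0 := fun θ hne => by
    have := gram_self_pos hB hw (sub_ne_zero.2 hne)
    rw [hΦ] at this
    linarith
  obtain ⟨θ, hθ, hfix⟩ := exists_mem_fixedPoint_of_descent
    (S := B ⁻¹' Metric.closedBall (B θs) r) ⟨θs, Metric.mem_closedBall_self hr⟩
    ((B.toLinearMap.isClosedEmbedding_of_injective
      (LinearMap.ker_eq_bot.2 hB)).isCompact_preimage (isCompact_closedBall _ _))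
    ((convex_closedBall _ _).linear_preimage B.toLinearMap)
    hasFDerivAt_logisticLoss hmaps descent
  refine ⟨θ, hθ, hfix, ?_⟩
  ext v
  simpa [hfix] using hΦ θ v

/-- If the linearised estimate `θs + p` is close to `θs` in every predictor, the frozen Newton
step preserves a neighbourhood of `θs`. -/
theorem exists_strict_minimizer (hB : Function.Injective B) (hm : 0 < m) (hκ : 0 < κ) {R T : ℝ}
    (hR : 0 ≤ R) (hT : 0 ≤ T) (hstar : ∀ e, |B θs e| ≤ Real.log κ)
    (hlev : ∀ e x, B x e ^ 2 ≤ R * energy B x)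
    (hp : ∀ v, gram B (fun e => m * sigmoidVar (B θs e)) p v = -logisticScore B m Y θs v)
    (hnoise : ∀ e, |B p e| ≤ 4 * κ * √(R * T))
    (hsmall : 4096 * κ ^ 4 * R ^ 2 * Fintype.card ι * T ≤ 1) :
    ∃ θ, (∀ θ', θ' ≠ θ → logisticLoss B m Y θ < logisticLoss B m Y θ') ∧
      energy B (θ - θs - p) ≤ 16 * κ ^ 2 * T := by
  set η : ℝ := 4 * κ * √(R * T) with hη
  have hη0 : 0 ≤ η := by positivity
  have hη2 : η ^ 2 = 16 * κ ^ 2 * (R * T) := by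
    rw [hη, mul_pow, Real.sq_sqrt (by positivity)]; ring
  set S : Set U := B ⁻¹' Metric.closedBall (B θs) (2 * η) with hS
  have mem_S : ∀ θ, θ ∈ S ↔ ∀ e, |B (θ - θs) e| ≤ 2 * η := fun θ => by
    rw [hS, Set.mem_preimage, mem_closedBall_iff_norm, ← map_sub, pi_norm_le_iff_of_nonneg
      (by positivity)]
    rfl
  choose Φ hΦ hΦs using exists_newton_step hB hm hκ hstar hp
  have energy_step : ∀ θ ∈ S, energy B (Φ θ - θs - p) ≤ 16 * κ ^ 2 * T := fun θ hθ =>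
    calc energy B (Φ θ - θs - p) ≤ 16 * κ ^ 2 * Fintype.card ι * (2 * η) ^ 4 :=
          hΦs θ _ ((mem_S θ).1 hθ)
      _ = 16 * κ ^ 2 * T * (4096 * κ ^ 4 * R ^ 2 * Fintype.card ι * T) := by
          rw [show (2 * η) ^ 4 = 16 * (η ^ 2) ^ 2 by ring, hη2]
          ring
      _ ≤ 16 * κ ^ 2 * T := mul_le_of_le_one_right (by positivity) hsmall
  have mapsTo : Set.MapsTo Φ S S := fun θ hθ => (mem_S _).2 fun e => by
    have deviation : |B (Φ θ - θs - p) e| ≤ η := by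
      refine abs_le_of_sq_le_sq ?_ hη0
      calc B (Φ θ - θs - p) e ^ 2 ≤ R * (16 * κ ^ 2 * T) :=
            (hlev e _).trans (mul_le_mul_of_nonneg_left (energy_step θ hθ) hR)
        _ = η ^ 2 := by rw [hη2]; ring
    calc |B (Φ θ - θs) e| = |B (Φ θ - θs - p) e + B p e| := by simp
      _ ≤ 2 * η := (abs_add_le _ _).trans (by linarith [hnoise e])
  obtain ⟨θ, hθS, hfix, hscore⟩ := exists_fixedPoint_logisticScore_eq_zero hB
    (fun e => mul_pos hm (sigmoidVar_pos (B θs e))) (by positivity) hΦ mapsTo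
  exact ⟨θ, fun θ' => logisticLoss_lt_of_logisticScore_eq_zero hB hm hscore,
    hfix ▸ energy_step θ hθS⟩

end LogisticRegression

section Concentration

open scoped NNReal

variable {Ω : Type*} [MeasurableSpace Ω] {P : Measure Ω}

lemma hasSubgaussianMGF_mono {X : Ω → ℝ} {c c' : ℝ≥0} (h : HasSubgaussianMGF X c P)
    (hc : c ≤ c') : HasSubgaussianMGF X c' P where
  integrable_exp_mul := h.integrable_exp_mul
  mgf_le t := (h.mgf_le t).trans (by gcongr)

variable [IsProbabilityMeasure P]

lemma hasSubgaussianMGF_bernoulli {Y : Ω → ℝ} (hY : Measurable Y) {p : ℝ} (hp0 : 0 ≤ p)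
    (hp1 : p ≤ 1) (h1 : P {ω | Y ω = 1} = ENNReal.ofReal p)
    (h0 : P {ω | Y ω = 0} = ENNReal.ofReal (1 - p)) :
    HasSubgaussianMGF (fun ω => Y ω - p) (1 / 4) P := by
  have meas_one : MeasurableSet {ω | Y ω = 1} := hY (measurableSet_singleton 1)
  have meas_zero : MeasurableSet {ω | Y ω = 0} := hY (measurableSet_singleton 0)
  have disj : Disjoint {ω | Y ω = 1} {ω | Y ω = 0} := Set.disjoint_left.2 fun ω h h' =>
    one_ne_zero (h.symm.trans h')
  have ae_values : ∀ᵐ ω ∂P, ω ∈ {ω | Y ω = 1} ∪ {ω | Y ω = 0} := by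
    refine (mem_ae_iff_prob_eq_one (meas_one.union meas_zero)).2 ?_
    rw [measure_union disj meas_zero, h1, h0, ← ENNReal.ofReal_add hp0 (sub_nonneg.2 hp1),
      add_sub_cancel, ENNReal.ofReal_one]
  have mean : ∫ ω, Y ω ∂P = p := by
    have ae_indicator : Y =ᵐ[P] Set.indicator {ω | Y ω = 1} 1 := by
      filter_upwards [ae_values] with ω hω
      rcases hω with h | h
      · rwa [Set.indicator_of_mem h]
      · rwa [Set.indicator_of_notMem fun h' => disj.le_bot ⟨h', h⟩]
    rw [integral_congr_ae ae_indicator, integral_indicator_one meas_one, measureReal_def, h1,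
      ENNReal.toReal_ofReal hp0]
  have mem_Icc : ∀ᵐ ω ∂P, Y ω ∈ Set.Icc 0 1 := by
    filter_upwards [ae_values] with ω hω
    rcases hω with h | h <;> rw [Set.mem_ofPred_eq] at h <;> simp [h]
  have := hasSubgaussianMGF_of_mem_Icc hY.aemeasurable mem_Icc
  rw [mean] at this
  convert this using 1
  norm_num

lemma measureReal_le_sum_bernoulli_le {ι : Type*} [Fintype ι] {Y : ι → Ω → ℝ}
    (hY : ∀ i, Measurable (Y i)) {p a : ι → ℝ} (hp0 : ∀ i, 0 ≤ p i) (hp1 : ∀ i, p i ≤ 1)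
    (h1 : ∀ i, P {ω | Y i ω = 1} = ENNReal.ofReal (p i))
    (h0 : ∀ i, P {ω | Y i ω = 0} = ENNReal.ofReal (1 - p i)) (hind : iIndepFun Y P)
    {W ε : ℝ} (hW : ∑ i, a i ^ 2 ≤ W) (hε : 0 ≤ ε) :
    P.real {ω | ε ≤ ∑ i, a i * (Y i ω - p i)} ≤ Real.exp (-(2 * ε ^ 2 / W)) := by
  have W_nonneg : 0 ≤ W := (Finset.sum_nonneg fun i _ => sq_nonneg _).trans hW
  have indep : iIndepFun (fun i ω => a i * (Y i ω - p i)) P :=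
    hind.comp (fun i z => a i * (z - p i)) fun i => by fun_prop
  have subgaussian := HasSubgaussianMGF.sum_of_iIndepFun indep (s := Finset.univ) fun i _ =>
    (hasSubgaussianMGF_bernoulli (hY i) (hp0 i) (hp1 i) (h1 i) (h0 i)).const_mul (a i)
  have tail := (hasSubgaussianMGF_mono subgaussian (c' := (W / 4).toNNReal) (by
    rw [← NNReal.coe_le_coe, Real.coe_toNNReal _ (by positivity), NNReal.coe_sum]
    calc ∑ i, a i ^ 2 * ((1 / 4 : ℝ≥0) : ℝ) = (∑ i, a i ^ 2) / 4 := by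
          rw [← Finset.sum_mul]; push_cast; ring
      _ ≤ W / 4 := by gcongr)).measure_ge_le hε
  rw [Real.coe_toNNReal _ (by positivity)] at tail
  convert tail using 2
  ring

lemma exists_measurableSet_forall_lt {J : Type*} [Fintype J] {N : J → Ω → ℝ}
    (hN : ∀ j, Measurable (N j)) {ε : J → ℝ} {q δ : ℝ}
    (htail : ∀ j, P.real {ω | ε j ≤ N j ω} ≤ q) (hq : Fintype.card J * q ≤ δ) :
    ∃ A, MeasurableSet A ∧ ENNReal.ofReal (1 - δ) ≤ P A ∧ ∀ ω ∈ A, ∀ j, N j ω < ε j := by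
  have meas : MeasurableSet (⋂ j, {ω | N j ω < ε j}) :=
    MeasurableSet.iInter fun j => measurableSet_lt (hN j) measurable_const
  have compl_eq : (⋂ j, {ω | N j ω < ε j})ᶜ = ⋃ j ∈ Finset.univ, {ω | ε j ≤ N j ω} := by
    ext ω
    simp
  have compl_le : P.real (⋂ j, {ω | N j ω < ε j})ᶜ ≤ δ := by
    rw [compl_eq]
    calc P.real (⋃ j ∈ Finset.univ, {ω | ε j ≤ N j ω})
        ≤ ∑ j, P.real {ω | ε j ≤ N j ω} := measureReal_biUnion_finset_le _ _
      _ ≤ ∑ _j : J, q := Finset.sum_le_sum fun j _ => htail j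
      _ ≤ δ := by simpa using hq
  refine ⟨_, meas, ?_, fun ω hω j => Set.mem_iInter.1 hω j⟩
  rw [measureReal_compl meas, probReal_univ] at compl_le
  rw [← ofReal_measureReal]
  exact ENNReal.ofReal_le_ofReal (by linarith)

end Concentration

section ZeroSum

variable {V : Type*} [Fintype V]

variable (V) in
/-- The score vectors whose entries sum to zero: the parameter space of the Bradley-Terry-Luce
model, which only sees differences of scores. -/
def zeroSum : Submodule ℝ (V → ℝ) := LinearMap.ker (∑ i, LinearMap.proj i : (V → ℝ) →ₗ[ℝ] ℝ)

lemma mem_zeroSum {x : V → ℝ} : x ∈ zeroSum V ↔ ∑ i, x i = 0 := by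
  simp [zeroSum]

lemma exists_mem_zeroSum_sub_eq [Nonempty V] (x : V → ℝ) :
    ∃ z ∈ zeroSum V, ∀ i j, z i - z j = x i - x j := by
  refine ⟨fun i => x i - (∑ j, x j) / Fintype.card V, mem_zeroSum.2 ?_, fun i j => by ring⟩
  rw [Finset.sum_sub_distrib, Finset.sum_const, Finset.card_univ, nsmul_eq_mul,
    mul_div_cancel₀ _ (by positivity), sub_self]

end ZeroSum

section Graph

variable {V : Type*} [LinearOrder V]

/-- The difference operator (transposed incidence matrix) of `G`, with the edges oriented upwards.
Its `energy` is the Dirichlet energy of `G`. -/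
noncomputable def edgeDiff (G : SimpleGraph V) : (V → ℝ) →L[ℝ] OrientedEdge G → ℝ :=
  ContinuousLinearMap.pi fun e => .proj e.1.1 - .proj e.1.2

@[simp]
lemma edgeDiff_apply (G : SimpleGraph V) (x : V → ℝ) (e : OrientedEdge G) :
    edgeDiff G x e = x e.1.1 - x e.1.2 := rfl

lemma IsSample.of_sub_eq {G : SimpleGraph V} {L : ℕ} {Ω : Type*} [MeasurableSpace Ω]
    {P : Measure Ω} {y : OrientedEdge G → Fin L → Ω → ℝ} {θ θ' : V → ℝ} (hy : IsSample P G L θ y)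
    (h : ∀ i j, θ' i - θ' j = θ i - θ j) : IsSample P G L θ' y where
  measurable := hy.measurable
  prob_one e l := by rw [h, hy.prob_one]
  prob_zero e l := by rw [h, hy.prob_zero]
  indep := hy.indep

variable [Fintype V]

open scoped Classical in
noncomputable instance (G : SimpleGraph V) : Fintype (OrientedEdge G) := inferInstance

/-- The restriction of `edgeDiff G` to `zeroSum V`, where it is injective if `G` is connected. -/
noncomputable def centeredEdgeDiff (G : SimpleGraph V) : zeroSum V →L[ℝ] OrientedEdge G → ℝ :=
  edgeDiff G ∘L (zeroSum V).subtypeL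

/-- The effective resistance between `k` and `l` in `G`, all edges having unit conductance, is at
most `ρ`. This is Dirichlet's variational characterisation, which makes sense for every `G`. -/
def ResistanceLE (G : SimpleGraph V) (k l : V) (ρ : ℝ) : Prop :=
  ∀ x : V → ℝ, (x k - x l) ^ 2 ≤ ρ * energy (edgeDiff G) x

variable {G : SimpleGraph V}

lemma ResistanceLE.mono {k l : V} {ρ ρ' : ℝ} (h : ResistanceLE G k l ρ) (hρ : ρ ≤ ρ') :
    ResistanceLE G k l ρ' := fun x =>
  (h x).trans (mul_le_mul_of_nonneg_right hρ (energy_nonneg _ x))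

lemma centeredEdgeDiff_injective {ρ : V → V → ℝ} (h : ∀ k l, ResistanceLE G k l (ρ k l)) :
    Function.Injective (centeredEdgeDiff G) := by
  refine (injective_iff_map_eq_zero _).2 fun x hx => ?_
  have energy_eq : energy (edgeDiff G) x = 0 := by
    have diff_eq : edgeDiff G x = 0 := hx
    simp only [energy, diff_eq, Pi.zero_apply, ne_eq, OfNat.ofNat_ne_zero, not_false_eq_true,
      zero_pow, Finset.sum_const_zero]
  have const : ∀ k l, x.1 k = x.1 l := fun k l => by
    have := h k l x
    rw [energy_eq, mul_zero] at this
    exact sub_eq_zero.1 (pow_eq_zero_iff two_ne_zero |>.1 (le_antisymm this (sq_nonneg _)))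
  ext k
  have card_mul_eq : (Fintype.card V : ℝ) * x.1 k = 0 := by
    rw [← mem_zeroSum.1 x.2, Finset.sum_congr rfl fun i _ => const i k]
    simp
  have : Nonempty V := ⟨k⟩
  exact (mul_eq_zero.1 card_mul_eq).resolve_left (by positivity)

end Graph

section Likelihood

variable {V : Type*} [LinearOrder V] [Fintype V] {G : SimpleGraph V} {L : ℕ}

lemma loss_eq_logisticLoss (y : OrientedEdge G → Fin L → ℝ) (θ : V → ℝ) :
    loss G L y θ = logisticLoss (edgeDiff G) L (fun e => ∑ l, y e l) θ := by
  simp only [loss, logisticLoss, softplus, edgeDiff_apply, Finset.sum_add_distrib, neg_mul,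
    Finset.sum_neg_distrib, ← Finset.sum_mul, Finset.sum_const, Finset.card_univ, Fintype.card_fin,
    nsmul_eq_mul, Finset.sum_sub_distrib]
  ring

lemma isMLE_iff_eq {y : OrientedEdge G → Fin L → ℝ} {θ : zeroSum V}
    (hθ : ∀ θ', θ' ≠ θ → logisticLoss (centeredEdgeDiff G) L (fun e => ∑ l, y e l) θ <
      logisticLoss (centeredEdgeDiff G) L (fun e => ∑ l, y e l) θ') (θ' : V → ℝ) :
    IsMLE G L y θ' ↔ θ' = θ := by
  have loss_lt : ∀ θ' ∈ zeroSum V, θ' ≠ θ → loss G L y θ < loss G L y θ' := fun θ' hmem hne => by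
    rw [loss_eq_logisticLoss, loss_eq_logisticLoss]
    exact hθ ⟨θ', hmem⟩ fun h => hne congr(($h : V → ℝ))
  constructor
  · rintro ⟨hsum, hmin⟩
    by_contra hne
    exact (hmin (mem_zeroSum.1 θ.2)).not_gt (loss_lt θ' (mem_zeroSum.2 hsum) hne)
  · rintro rfl
    refine ⟨mem_zeroSum.1 θ.2, fun θ' hθ' => ?_⟩
    rcases eq_or_ne θ' θ with rfl | hne
    · exact le_refl (loss G L y θ)
    · exact (loss_lt θ' (mem_zeroSum.2 hθ') hne).le

/-- The conclusion of an error analysis: with probability at least `1 - δ` there is exactly one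
maximum likelihood estimate, and it recovers each score difference `θs k - θs l` up to an error of
at most `err k l`. -/
def MLEErrorLE {Ω : Type*} [MeasurableSpace Ω] (P : Measure Ω) (G : SimpleGraph V)
    (y : OrientedEdge G → Fin L → Ω → ℝ) (θs : V → ℝ) (δ : ℝ) (err : V → V → ℝ) : Prop :=
  ∃ A : Set Ω, MeasurableSet A ∧ ENNReal.ofReal (1 - δ) ≤ P A ∧ ∀ ω ∈ A,
    (∃! θ : V → ℝ, IsMLE G L (fun e l => y e l ω) θ) ∧
    ∀ θ : V → ℝ, IsMLE G L (fun e l => y e l ω) θ →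
      ∀ k l : V, |(θ k - θ l) - (θs k - θs l)| ≤ err k l

variable {κ : ℝ} {θs : zeroSum V} {ρ : Sym2 V → ℝ}

/-- By symmetry of the weighted Laplacian, the linearised error at `(k, l)` is the noise evaluated
at the potential `g k l` of a unit current from `k` to `l`. -/
lemma exists_forall_isMLE_iff (hL : 0 < L) (hκ : 0 < κ) {R T : ℝ} (hT : 0 ≤ T)
    (hstar : ∀ e, |edgeDiff G θs e| ≤ Real.log κ) (hρ : ∀ k l, ResistanceLE G k l (ρ s(k, l)))
    (hρ0 : ∀ e, 0 ≤ ρ e) (hρR : ∀ e ∈ G.edgeSet, ρ e ≤ R) (hR : 0 ≤ R)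
    (hsmall : 4096 * κ ^ 4 * R ^ 2 * Fintype.card (OrientedEdge G) * T ≤ 1)
    {g : V → V → zeroSum V}
    (hg : ∀ k l v, gram (centeredEdgeDiff G) (fun e => L * sigmoidVar (edgeDiff G θs e)) (g k l) v =
      v.1 k - v.1 l)
    {y : OrientedEdge G → Fin L → ℝ}
    (hnoise : ∀ k l, -logisticScore (centeredEdgeDiff G) L (fun e => ∑ l, y e l) θs (g k l) ≤
      4 * κ * √(ρ s(k, l) * T)) :
    ∃ θ : V → ℝ, (∀ θ', IsMLE G L y θ' ↔ θ' = θ) ∧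
      ∀ k l, |(θ k - θ l) - (θs.1 k - θs.1 l)| ≤ 8 * κ * √(ρ s(k, l) * T) := by
  have hB : Function.Injective (centeredEdgeDiff G) := centeredEdgeDiff_injective hρ
  have hL' : (0 : ℝ) < L := Nat.cast_pos.2 hL
  obtain ⟨p, hp⟩ := exists_gram_eq hB (fun e => mul_pos hL' (sigmoidVar_pos (edgeDiff G θs e)))
    (-logisticScore (centeredEdgeDiff G) L (fun e => ∑ l, y e l) θs).toLinearMap
  have p_le : ∀ k l, p.1 k - p.1 l ≤ 4 * κ * √(ρ s(k, l) * T) := fun k l => by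
    rw [← hg, gram_comm, hp]
    exact hnoise k l
  have abs_p_le : ∀ k l, |p.1 k - p.1 l| ≤ 4 * κ * √(ρ s(k, l) * T) := fun k l =>
    abs_sub_le_iff.2 ⟨p_le k l, Sym2.eq_swap (a := l) (b := k) ▸ p_le l k⟩
  have edge_le : ∀ e : OrientedEdge G, ρ s(e.1.1, e.1.2) ≤ R := fun e => hρR _ e.2.1
  obtain ⟨θ, hmin, hθ⟩ := exists_strict_minimizer (θs := θs) (p := p) hB hL' hκ hR hT hstar
    (fun e x => (hρ _ _ x).trans
      (mul_le_mul_of_nonneg_right (edge_le e) (energy_nonneg _ _)))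
    hp (fun e => (abs_p_le _ _).trans (by have := edge_le e; gcongr)) hsmall
  refine ⟨θ, isMLE_iff_eq hmin, fun k l => ?_⟩
  set d : V → ℝ := fun i => θ.1 i - θs.1 i - p.1 i with hd
  have sq_le : (d k - d l) ^ 2 ≤ (4 * κ * √(ρ s(k, l) * T)) ^ 2 := by
    rw [mul_pow, Real.sq_sqrt (mul_nonneg (hρ0 _) hT)]
    calc (d k - d l) ^ 2 ≤ ρ s(k, l) * (16 * κ ^ 2 * T) :=
          (hρ k l d).trans (mul_le_mul_of_nonneg_left hθ (hρ0 _))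
      _ = (4 * κ) ^ 2 * (ρ s(k, l) * T) := by ring
  have abs_d_le := abs_le_of_sq_le_sq sq_le (by positivity)
  calc |(θ.1 k - θ.1 l) - (θs.1 k - θs.1 l)| = |(d k - d l) + (p.1 k - p.1 l)| := by
        rw [hd]; ring_nf
    _ ≤ 8 * κ * √(ρ s(k, l) * T) := (abs_add_le _ _).trans (by linarith [abs_p_le k l])

variable {Ω : Type*} [MeasurableSpace Ω] {P : Measure Ω} {y : OrientedEdge G → Fin L → Ω → ℝ}

lemma MLEErrorLE.mono {θs : V → ℝ} {δ : ℝ} {err err' : V → V → ℝ}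
    (h : MLEErrorLE P G y θs δ err) (herr : ∀ k l, err k l ≤ err' k l) :
    MLEErrorLE P G y θs δ err' := by
  obtain ⟨A, hA, hPA, hgood⟩ := h
  exact ⟨A, hA, hPA, fun ω hω =>
    ⟨(hgood ω hω).1, fun θ hθ k l => ((hgood ω hω).2 θ hθ k l).trans (herr k l)⟩⟩

variable [IsProbabilityMeasure P]

lemma measureReal_le_neg_logisticScore_le (hy : IsSample P G L θs y) {v : zeroSum V} {W ε : ℝ}
    (hW : energy (centeredEdgeDiff G) v ≤ W) (hε : 0 ≤ ε) :
    P.real {ω | ε ≤ -logisticScore (centeredEdgeDiff G) L (fun e => ∑ l, y e l ω) θs v} ≤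
      Real.exp (-(2 * ε ^ 2 / (L * W))) := by
  have neg_score_eq : ∀ ω, -logisticScore (centeredEdgeDiff G) L (fun e => ∑ l, y e l ω) θs v =
      ∑ x : OrientedEdge G × Fin L, centeredEdgeDiff G v x.1 *
        (y x.1 x.2 ω - Real.sigmoid (edgeDiff G θs x.1)) := fun ω => by
    rw [logisticScore_apply, Fintype.sum_prod_type, ← Finset.sum_neg_distrib]
    refine Finset.sum_congr rfl fun e _ => ?_
    dsimp only
    rw [← Finset.mul_sum, Finset.sum_sub_distrib, Finset.sum_const, Finset.card_univ,
      Fintype.card_fin, nsmul_eq_mul]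
    change -((L * Real.sigmoid (edgeDiff G θs e) - _) * _) = _
    ring
  simp only [neg_score_eq]
  refine measureReal_le_sum_bernoulli_le
    (p := fun x : OrientedEdge G × Fin L => Real.sigmoid (edgeDiff G θs x.1))
    (fun x => hy.measurable x.1 x.2)
    (fun x => Real.sigmoid_nonneg _) (fun x => Real.sigmoid_le_one _)
    (fun x => hy.prob_one x.1 x.2) (fun x => hy.prob_zero x.1 x.2) hy.indep ?_ hε
  rw [Fintype.sum_prod_type]
  simp only [Finset.sum_const, Finset.card_univ, Fintype.card_fin, nsmul_eq_mul, ← Finset.mul_sum]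
  exact mul_le_mul_of_nonneg_left hW (Nat.cast_nonneg L)

lemma exp_neg_two_mul_log_div {n δ : ℝ} (hn : 0 < n) (hδ : 0 < δ) :
    Real.exp (-(2 * Real.log (n / δ))) = (δ / n) ^ 2 := by
  rw [← mul_neg, ← Real.log_inv, inv_div, mul_comm, Real.exp_mul, Real.exp_log (by positivity),
    Real.rpow_two]

/-- The potential `g` has energy at most `ρ / c ^ 2`, where `c = L / (4 * κ)` bounds the weights
from below. -/
lemma exists_gram_eq_sub_and_tail_le (hinj : Function.Injective (centeredEdgeDiff G)) (hL : 0 < L)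
    (hκ : 0 < κ) (hstar : ∀ e, |edgeDiff G θs e| ≤ Real.log κ) (hy : IsSample P G L θs y) {k l : V}
    {ρ T : ℝ} (hρ0 : 0 < ρ) (hT : 0 ≤ T) (hρ : ResistanceLE G k l ρ) :
    ∃ g, (∀ v, gram (centeredEdgeDiff G) (fun e => L * sigmoidVar (edgeDiff G θs e)) g v =
        v.1 k - v.1 l) ∧
      P.real {ω | 4 * κ * √(ρ * T) ≤
        -logisticScore (centeredEdgeDiff G) L (fun e => ∑ l, y e l ω) θs g} ≤
        Real.exp (-(2 * (L * T))) := by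
  have hL' : (0 : ℝ) < L := Nat.cast_pos.2 hL
  obtain ⟨g, hg⟩ := exists_gram_eq hinj
    (fun e => mul_pos hL' (sigmoidVar_pos (edgeDiff G θs e)))
    ((LinearMap.proj (R := ℝ) (φ := fun _ : V => ℝ) k - LinearMap.proj l) ∘ₗ (zeroSum V).subtype)
  have weight_ge : ∀ e, L * (4 * κ)⁻¹ ≤ L * sigmoidVar (edgeDiff G θs e) := fun e =>
    mul_le_mul_of_nonneg_left (inv_four_mul_le_sigmoidVar hκ (hstar e)) hL'.le
  have energy_le : energy (centeredEdgeDiff G) g ≤ ρ / (L * (4 * κ)⁻¹) ^ 2 := by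
    rw [le_div_iff₀ (by positivity), mul_comm]
    exact sq_mul_energy_le_of_gram_eq (B := centeredEdgeDiff G) (by positivity) weight_ge hρ0.le
      (fun x => hρ x) hg
  refine ⟨g, hg, (measureReal_le_neg_logisticScore_le hy energy_le (by positivity)).trans_eq ?_⟩
  rw [mul_pow, Real.sq_sqrt (by positivity)]
  congr 2
  field_simp

theorem mleErrorLE_of_resistanceLE [Nonempty V] (hL : 0 < L) (hκ : 0 < κ) {θs : V → ℝ} {δ R : ℝ}
    (hδ : 0 < δ) (hδ1 : δ < 1) (hR : 0 ≤ R) (hρ0 : ∀ e, 0 < ρ e)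
    (hρ : ∀ k l, ResistanceLE G k l (ρ s(k, l))) (hρR : ∀ e ∈ G.edgeSet, ρ e ≤ R)
    (hstar : ∀ i j, G.Adj i j → |θs i - θs j| ≤ Real.log κ)
    (hcond : 4096 * κ ^ 4 * R ^ 2 * Fintype.card (OrientedEdge G) *
      Real.log (Fintype.card V / δ) ≤ L) (hy : IsSample P G L θs y) :
    MLEErrorLE P G y θs δ fun k l =>
      8 * κ * √(ρ s(k, l) * (Real.log (Fintype.card V / δ) / L)) := by
  obtain ⟨z, hz, hzsub⟩ := exists_mem_zeroSum_sub_eq θs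
  lift z to zeroSum V using hz
  have hL' : (0 : ℝ) < L := Nat.cast_pos.2 hL
  have one_le_card : (1 : ℝ) ≤ Fintype.card V := Nat.one_le_cast.2 Fintype.card_pos
  set T : ℝ := Real.log (Fintype.card V / δ) / L with hT
  have T_nonneg : 0 ≤ T :=
    div_nonneg (Real.log_nonneg ((one_le_div hδ).2 (hδ1.le.trans one_le_card))) hL'.le
  have star_le : ∀ e, |edgeDiff G z e| ≤ Real.log κ := fun e => by
    rw [edgeDiff_apply, hzsub]
    exact hstar _ _ e.2.1
  choose g hg tail using fun k l => exists_gram_eq_sub_and_tail_le (centeredEdgeDiff_injective hρ)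
    hL hκ star_le (hy.of_sub_eq hzsub) (hρ0 s(k, l)) T_nonneg (hρ k l)
  rw [hT, mul_div_cancel₀ _ hL'.ne', exp_neg_two_mul_log_div (by positivity) hδ] at tail
  have measurable_score : ∀ k l, Measurable fun ω =>
      -logisticScore (centeredEdgeDiff G) L (fun e => ∑ l, y e l ω) z (g k l) := fun k l => by
    have := hy.measurable
    simp only [logisticScore_apply]
    fun_prop
  have union_bound : Fintype.card (V × V) * (δ / Fintype.card V) ^ 2 ≤ δ := by
    rw [Fintype.card_prod, Nat.cast_mul]
    field_simp
    exact hδ1.le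
  obtain ⟨A, hA, hPA, hgood⟩ := exists_measurableSet_forall_lt
    (fun kl : V × V => measurable_score kl.1 kl.2) (fun kl => tail kl.1 kl.2) union_bound
  refine ⟨A, hA, hPA, fun ω hω => ?_⟩
  obtain ⟨θ, hθ, herr⟩ := exists_forall_isMLE_iff hL hκ T_nonneg star_le hρ
    (fun e => (hρ0 e).le) hρR hR (by rwa [hT, ← mul_div_assoc, div_le_one hL'])
    hg fun k l => (hgood ω hω (k, l)).le
  refine ⟨⟨θ, (hθ θ).2 rfl, fun θ' => (hθ θ').1⟩, fun θ' hθ' k l => ?_⟩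
  rw [(hθ θ').1 hθ', ← hzsub k l]
  exact herr k l

lemma mleErrorLE_of_isEmpty [IsEmpty V] (θs : V → ℝ) {δ : ℝ} (hδ : 0 < δ) (err : V → V → ℝ) :
    MLEErrorLE P G y θs δ err := by
  refine ⟨Set.univ, MeasurableSet.univ, ?_, fun ω _ =>
    ⟨⟨θs, ⟨Fintype.sum_empty _, fun θ _ => ?_⟩, fun θ _ => Subsingleton.elim _ _⟩,
      fun _ _ k => isEmptyElim k⟩⟩
  · rw [measure_univ]
    exact ENNReal.ofReal_le_one.2 (by linarith)
  · exact (congrArg (loss G L fun e l => y e l ω) (Subsingleton.elim θs θ)).le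

/-- The condition on the number of samples in the form shared by the two grids: `q` is, up to
constants, the degree of a node, and `a / q` the effective resistance across an edge. -/
theorem mleErrorLE_of_local_resistanceLE [Nonempty V] {θs : V → ℝ} {δ a c q X : ℝ} (ha : 0 < a)
    (hc : 0 < c) (hq : 0 ≤ q) (hX : 1 ≤ X) (hκ : 1 ≤ κ) (hδ : 0 < δ) (hδ1 : δ < 1)
    (hcard : Fintype.card (OrientedEdge G) ≤ c * (Fintype.card V * q))
    (hedge : ∀ i j, G.Adj i j → ResistanceLE G i j (a / q))
    (hall : ∀ i j, ResistanceLE G i j (a * X / q))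
    (hstar : ∀ i j, G.Adj i j → |θs i - θs j| ≤ Real.log κ) (hy : IsSample P G L θs y)
    (hcond : 4096 * a ^ 2 * c * (κ ^ 4 * Fintype.card V * Real.log (Fintype.card V / δ)) ≤ q * L) :
    MLEErrorLE P G y θs δ fun _ _ =>
      8 * √a * (κ * √(X * (1 / (q * L)) * Real.log (Fintype.card V / δ))) := by
  classical
  have one_le_card : (1 : ℝ) ≤ Fintype.card V := Nat.one_le_cast.2 Fintype.card_pos
  have log_pos : 0 < Real.log (Fintype.card V / δ) :=
    Real.log_pos ((one_lt_div hδ).2 (hδ1.trans_le one_le_card))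
  have qL_pos : 0 < q * L := lt_of_lt_of_le (by positivity) hcond
  have q_pos : 0 < q := pos_of_mul_pos_left qL_pos (Nat.cast_nonneg L)
  have L_pos : (0 : ℝ) < L := pos_of_mul_pos_right qL_pos hq
  have ratio_le : a / q ≤ a * X / q := by gcongr; exact le_mul_of_one_le_right ha.le hX
  set ρ : Sym2 V → ℝ := fun e => if e ∈ G.edgeSet then a / q else a * X / q with hρ
  have ρ_le : ∀ e, ρ e ≤ a * X / q := fun e => by
    rw [hρ]; dsimp only; split_ifs <;> simp [ratio_le]
  refine (mleErrorLE_of_resistanceLE (ρ := ρ) (R := a / q) (Nat.cast_pos.1 L_pos)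
    (zero_lt_one.trans_le hκ) hδ hδ1 (by positivity) (fun e => ?_) (fun k l => ?_)
    (fun e he => by simp [hρ, he]) hstar ?_ hy).mono fun k l => ?_
  · rw [hρ]; dsimp only; split_ifs <;> positivity
  · rw [hρ]
    dsimp only
    split_ifs with h
    exacts [hedge k l h, hall k l]
  · calc 4096 * κ ^ 4 * (a / q) ^ 2 * Fintype.card (OrientedEdge G) *
          Real.log (Fintype.card V / δ)
        ≤ 4096 * κ ^ 4 * (a / q) ^ 2 * (c * (Fintype.card V * q)) *
          Real.log (Fintype.card V / δ) := by gcongr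
      _ = 4096 * a ^ 2 * c * (κ ^ 4 * Fintype.card V * Real.log (Fintype.card V / δ)) / q := by
          field_simp
      _ ≤ L := by rwa [div_le_iff₀' q_pos]
  · calc 8 * κ * √(ρ s(k, l) * (Real.log (Fintype.card V / δ) / L))
        ≤ 8 * κ * √(a * X / q * (Real.log (Fintype.card V / δ) / L)) := by
          gcongr
          exact ρ_le _
      _ = 8 * κ * √(a * (X * (1 / (q * L)) * Real.log (Fintype.card V / δ))) := by
          congr 2; field_simp
      _ = 8 * √a * (κ * √(X * (1 / (q * L)) * Real.log (Fintype.card V / δ))) := by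
          rw [Real.sqrt_mul ha.le]; ring

end Likelihood

section Averages

open scoped BigOperators

lemma sum_comp_le_of_injOn {α β : Type*} {s : Finset α} {t : Finset β} {φ : α → β} {F : β → ℝ}
    (hφ : Set.InjOn φ s) (hst : Set.MapsTo φ s t) (hF : ∀ b ∈ t, 0 ≤ F b) :
    ∑ a ∈ s, F (φ a) ≤ ∑ b ∈ t, F b := by
  classical
  rw [← Finset.sum_image (f := F) hφ]
  exact Finset.sum_le_sum_of_subset_of_nonneg (Finset.image_subset_iff.2 hst) fun b hb _ => hF b hb

lemma sq_expect_le {α : Type*} (s : Finset α) (z : α → ℝ) :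
    (𝔼 i ∈ s, z i) ^ 2 ≤ 𝔼 i ∈ s, z i ^ 2 := by
  rw [Finset.expect_eq_sum_div_card, Finset.expect_eq_sum_div_card]
  exact sum_div_card_sq_le_sum_sq_div_card

lemma sq_expect_sub_le {α : Type*} {s : Finset α} (hs : s.Nonempty) (z : α → ℝ) (c : ℝ) :
    (𝔼 i ∈ s, z i - c) ^ 2 ≤ 𝔼 i ∈ s, (z i - c) ^ 2 := by
  refine le_of_eq_of_le ?_ (sq_expect_le s fun i => z i - c)
  rw [Finset.expect_sub_distrib, Finset.expect_const hs]

lemma sq_expect_sub_expect_le {α β : Type*} {s : Finset α} {t : Finset β} (hs : s.Nonempty)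
    (ht : t.Nonempty) (z : α → ℝ) (w : β → ℝ) :
    (𝔼 i ∈ s, z i - 𝔼 j ∈ t, w j) ^ 2 ≤ 𝔼 i ∈ s, 𝔼 j ∈ t, (z i - w j) ^ 2 := by
  refine (sq_expect_sub_le hs z _).trans (Finset.expect_le_expect fun i _ => ?_)
  simpa only [sub_sq_comm (z i)] using sq_expect_sub_le ht w (z i)

end Averages

section Lattice

open Finset.HasAntidiagonal (antidiagonal mem_antidiagonal)

open scoped BigOperators

/-- The Dirichlet energy of a function on the path `{0, …, K}`. -/
def pathEnergy (K : ℕ) (Z : ℕ → ℝ) : ℝ := ∑ i ∈ Finset.range K, (Z (i + 1) - Z i) ^ 2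

lemma pathEnergy_nonneg (K : ℕ) (Z : ℕ → ℝ) : 0 ≤ pathEnergy K Z :=
  Finset.sum_nonneg fun _ _ => sq_nonneg _

lemma pathEnergy_comp_le_of_injOn {D K : ℕ} {f e : ℕ → ℕ} {Z : ℕ → ℝ}
    (he : Set.InjOn e (Finset.range D)) (heK : Set.MapsTo e (Finset.range D) (Finset.range K))
    (hfe : ∀ i < D, (Z (f (i + 1)) - Z (f i)) ^ 2 = (Z (e i + 1) - Z (e i)) ^ 2) :
    pathEnergy D (Z ∘ f) ≤ pathEnergy K Z :=
  (Finset.sum_congr rfl fun i hi => hfe i (Finset.mem_range.1 hi)).trans_le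
    (sum_comp_le_of_injOn (F := fun i => (Z (i + 1) - Z i) ^ 2) he heK fun _ _ => sq_nonneg _)

lemma sq_sub_le_pathEnergy {Z : ℕ → ℝ} {K d a b : ℕ} (ha : a ≤ K) (hb : b ≤ K) (hab : a ≤ b + d)
    (hba : b ≤ a + d) : (Z a - Z b) ^ 2 ≤ d * pathEnergy K Z := by
  wlog hle : a ≤ b generalizing a b
  · rw [sub_sq_comm]
    exact this hb ha hba hab (le_of_not_ge hle)
  obtain ⟨m, rfl⟩ := Nat.exists_eq_add_of_le hle
  have telescope : Z (a + m) - Z a = ∑ i ∈ Finset.range m, (Z (a + (i + 1)) - Z (a + i)) :=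
    (Finset.sum_range_sub (fun i => Z (a + i)) m).symm
  have segment_le : pathEnergy m (Z ∘ (a + ·)) ≤ pathEnergy K Z :=
    pathEnergy_comp_le_of_injOn (add_right_injective a).injOn
      (fun i hi => by simp only [Finset.coe_range, Set.mem_Iio] at hi ⊢; omega) fun _ _ => rfl
  rw [sub_sq_comm, telescope]
  calc _ ≤ (m : ℝ) * pathEnergy m (Z ∘ (a + ·)) := by
        simpa only [Finset.card_range, pathEnergy, Function.comp_apply] using
          sq_sum_le_card_mul_sum_sq (s := Finset.range m)
            (f := fun i => Z (a + (i + 1)) - Z (a + i))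
    _ ≤ d * pathEnergy K Z := by
        have := pathEnergy_nonneg m (Z ∘ (a + ·))
        gcongr
        omega

lemma pathEnergy_expect_le {α : Type*} (s : Finset α) (K : ℕ) (Z : α → ℕ → ℝ) :
    pathEnergy K (fun i => 𝔼 a ∈ s, Z a i) ≤ 𝔼 a ∈ s, pathEnergy K (Z a) := by
  simp only [pathEnergy, Finset.expect_sum_comm, ← Finset.expect_sub_distrib]
  exact Finset.sum_le_sum fun i _ => sq_expect_le s _

/-- The energy of the horizontal edges of the square lattice `{0, …, K}²`. -/
def horizontalEnergy (K : ℕ) (X : ℕ → ℕ → ℝ) : ℝ :=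
  ∑ j ∈ Finset.range (K + 1), pathEnergy K fun i => X i j

/-- The Dirichlet energy of a function on the square lattice `{0, …, K}²`. -/
def latticeEnergy (K : ℕ) (X : ℕ → ℕ → ℝ) : ℝ :=
  horizontalEnergy K X + horizontalEnergy K (Function.swap X)

lemma horizontalEnergy_nonneg (K : ℕ) (X : ℕ → ℕ → ℝ) : 0 ≤ horizontalEnergy K X :=
  Finset.sum_nonneg fun _ _ => pathEnergy_nonneg K _

lemma latticeEnergy_nonneg (K : ℕ) (X : ℕ → ℕ → ℝ) : 0 ≤ latticeEnergy K X :=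
  add_nonneg (horizontalEnergy_nonneg K X) (horizontalEnergy_nonneg K _)

lemma pathEnergy_le_horizontalEnergy {K j : ℕ} (X : ℕ → ℕ → ℝ) (hj : j ≤ K) :
    (pathEnergy K fun i => X i j) ≤ horizontalEnergy K X :=
  Finset.single_le_sum (f := fun j => pathEnergy K fun i => X i j)
    (fun _ _ => pathEnergy_nonneg K _) (Finset.mem_range.2 (Nat.lt_succ_of_le hj))

lemma sum_pathEnergy_comp_le {D K : ℕ} {g : ℕ → ℕ} (X : ℕ → ℕ → ℝ)
    (hg : Set.InjOn g (Finset.range (D + 1)))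
    (hgK : Set.MapsTo g (Finset.range (D + 1)) (Finset.range (K + 1))) :
    (∑ j ∈ Finset.range (D + 1), pathEnergy K fun i => X i (g j)) ≤ horizontalEnergy K X :=
  sum_comp_le_of_injOn (F := fun j => pathEnergy K fun i => X i j) hg hgK
    fun _ _ => pathEnergy_nonneg K _

lemma horizontalEnergy_comp_le {D K : ℕ} {f g : ℕ → ℕ} (X : ℕ → ℕ → ℝ)
    (hf : ∀ Z, pathEnergy D (Z ∘ f) ≤ pathEnergy K Z) (hg : Set.InjOn g (Finset.range (D + 1)))
    (hgK : Set.MapsTo g (Finset.range (D + 1)) (Finset.range (K + 1))) :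
    horizontalEnergy D (fun i j => X (f i) (g j)) ≤ horizontalEnergy K X :=
  (Finset.sum_le_sum fun j _ => hf fun i => X i (g j)).trans (sum_pathEnergy_comp_le X hg hgK)

lemma exists_straight_walk {K k : ℕ} (hk : k ≤ K) :
    ∃ f : ℕ → ℕ, f 0 = k ∧
      Set.MapsTo f (Finset.range (K / 2 + 1)) (Finset.range (K + 1)) ∧
      Set.InjOn f (Finset.range (K / 2 + 1)) ∧
      ∀ Z, pathEnergy (K / 2) (Z ∘ f) ≤ pathEnergy K Z := by
  simp only [Set.MapsTo, Set.InjOn, Finset.coe_range, Set.mem_Iio]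
  by_cases h : k + K / 2 ≤ K
  · refine ⟨(k + ·), rfl, by grind, by grind, fun Z =>
      pathEnergy_comp_le_of_injOn (e := (k + ·)) ?_ ?_ fun i _ => rfl⟩
    · exact (add_right_injective k).injOn
    · simp only [Set.MapsTo, Finset.coe_range, Set.mem_Iio]; grind
  · refine ⟨(k - ·), rfl, by grind, by grind, fun Z =>
      pathEnergy_comp_le_of_injOn (e := (k - 1 - ·)) ?_ ?_ fun i hi => ?_⟩
    · simp only [Set.InjOn, Finset.coe_range, Set.mem_Iio]; grind
    · simp only [Set.MapsTo, Finset.coe_range, Set.mem_Iio]; grind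
    · rw [show k - (i + 1) = k - 1 - i by omega, show k - i = k - 1 - i + 1 by omega, sub_sq_comm]

/-- The weights `(p.1 + 1) / (d + 2)` and `(p.2 + 1) / (d + 2)` transport the uniform distribution
on one antidiagonal to the uniform distribution on the next. -/
lemma expect_antidiagonal_succ_sub (Y : ℕ → ℕ → ℝ) (d : ℕ) :
    𝔼 p ∈ antidiagonal (d + 1), Y p.1 p.2 - 𝔼 p ∈ antidiagonal d, Y p.1 p.2 =
      𝔼 p ∈ antidiagonal d, ((p.1 + 1 : ℝ) / (d + 2) * (Y (p.1 + 1) p.2 - Y p.1 p.2) +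
        (p.2 + 1 : ℝ) / (d + 2) * (Y p.1 (p.2 + 1) - Y p.1 p.2)) := by
  have sum_succ : ∑ p ∈ antidiagonal d, ((p.1 + 1 : ℝ) * Y (p.1 + 1) p.2 +
      (p.2 + 1 : ℝ) * Y p.1 (p.2 + 1)) = (d + 1) * ∑ p ∈ antidiagonal (d + 1), Y p.1 p.2 := by
    have left := Finset.Nat.sum_antidiagonal_succ (n := d) (f := fun p => (p.1 : ℝ) * Y p.1 p.2)
    have right := Finset.Nat.sum_antidiagonal_succ' (n := d) (f := fun p => (p.2 : ℝ) * Y p.1 p.2)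
    simp only [Nat.cast_zero, zero_mul, zero_add, Nat.cast_add, Nat.cast_one] at left right
    rw [Finset.sum_add_distrib, ← left, ← right, ← Finset.sum_add_distrib, Finset.mul_sum]
    refine Finset.sum_congr rfl fun p hp => ?_
    rw [← add_mul, ← Nat.cast_add, mem_antidiagonal.1 hp, Nat.cast_succ]
  have sum_self : ∑ p ∈ antidiagonal d, ((p.1 + 1 : ℝ) * Y p.1 p.2 + (p.2 + 1 : ℝ) * Y p.1 p.2) =
      (d + 2) * ∑ p ∈ antidiagonal d, Y p.1 p.2 := by
    rw [Finset.mul_sum]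
    refine Finset.sum_congr rfl fun p hp => ?_
    rw [← mem_antidiagonal.1 hp]
    push_cast
    ring
  simp only [Finset.expect_eq_sum_div_card, Finset.Nat.card_antidiagonal]
  calc _ = ((d + 1) * ∑ p ∈ antidiagonal (d + 1), Y p.1 p.2 -
          (d + 2) * ∑ p ∈ antidiagonal d, Y p.1 p.2) / (d + 2) / (d + 1 : ℕ) := by
        push_cast
        field_simp
        ring
    _ = _ := by
        rw [← sum_succ, ← sum_self, ← Finset.sum_sub_distrib, Finset.sum_div]
        congr 1
        refine Finset.sum_congr rfl fun p _ => ?_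
        ring

lemma sq_expect_antidiagonal_succ_sub_le (Y : ℕ → ℕ → ℝ) (d : ℕ) :
    (𝔼 p ∈ antidiagonal (d + 1), Y p.1 p.2 - 𝔼 p ∈ antidiagonal d, Y p.1 p.2) ^ 2 ≤
      2 / (d + 1) * ∑ p ∈ antidiagonal d,
        ((Y (p.1 + 1) p.2 - Y p.1 p.2) ^ 2 + (Y p.1 (p.2 + 1) - Y p.1 p.2) ^ 2) := by
  rw [expect_antidiagonal_succ_sub]
  refine (sq_expect_le _ _).trans ?_
  rw [Finset.expect_eq_sum_div_card, Finset.Nat.card_antidiagonal, div_mul_eq_mul_div,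
    Finset.mul_sum, Nat.cast_succ]
  gcongr with p hp
  have sum_eq : (p.1 : ℝ) + p.2 = d := by exact_mod_cast mem_antidiagonal.1 hp
  have sq_mul_le : ∀ (j : ℕ) (v : ℝ), (j : ℝ) ≤ d → ((j + 1 : ℝ) / (d + 2) * v) ^ 2 ≤ v ^ 2 :=
    fun j v hj => by
      rw [mul_pow]
      exact mul_le_of_le_one_left (sq_nonneg v) (pow_le_one₀ (by positivity)
        ((div_le_one (by positivity)).2 (by linarith)))
  refine add_sq_le.trans ?_
  exact mul_le_mul_of_nonneg_left
    (add_le_add (sq_mul_le _ _ (by linarith [Nat.cast_nonneg (α := ℝ) p.2]))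
      (sq_mul_le _ _ (by linarith [Nat.cast_nonneg (α := ℝ) p.1]))) two_pos.le

lemma sum_two_div_le (D : ℕ) :
    ∑ d ∈ Finset.range D, (2 : ℝ) / (d + 1) ≤ 2 * (1 + Real.log D) := by
  have h := harmonic_le_one_add_log D
  rw [harmonic] at h
  push_cast at h
  simp only [div_eq_mul_inv, ← Finset.mul_sum]
  gcongr

lemma sum_antidiagonal_sq_sub_le_horizontalEnergy (Y : ℕ → ℕ → ℝ) (D : ℕ) :
    ∑ d ∈ Finset.range D, ∑ p ∈ antidiagonal d, (Y (p.1 + 1) p.2 - Y p.1 p.2) ^ 2 ≤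
      horizontalEnergy D Y := by
  simp only [horizontalEnergy, pathEnergy,
    Finset.Nat.sum_antidiagonal_eq_sum_range_succ fun i j => (Y (i + 1) j - Y i j) ^ 2]
  rw [Finset.sum_range_diag_flip D fun i j => (Y (i + 1) j - Y i j) ^ 2, Finset.sum_comm]
  gcongr
  omega

lemma sq_expect_antidiagonal_sub_corner_le (Y : ℕ → ℕ → ℝ) (D : ℕ) :
    (𝔼 p ∈ antidiagonal D, Y p.1 p.2 - Y 0 0) ^ 2 ≤
      2 * (1 + Real.log D) * latticeEnergy D Y := by
  have telescope := Finset.sum_range_sub (fun d => 𝔼 p ∈ antidiagonal d, Y p.1 p.2) D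
  simp only [Finset.Nat.antidiagonal_zero, Finset.expect_singleton] at telescope
  have triangle_le : ∑ d ∈ Finset.range D, ∑ p ∈ antidiagonal d,
      ((Y (p.1 + 1) p.2 - Y p.1 p.2) ^ 2 + (Y p.1 (p.2 + 1) - Y p.1 p.2) ^ 2) ≤
        latticeEnergy D Y := by
    have vertical := sum_antidiagonal_sq_sub_le_horizontalEnergy (Function.swap Y) D
    simp only [← Finset.Nat.sum_antidiagonal_swap (f := fun p => (Function.swap Y (p.1 + 1) p.2 -
      Function.swap Y p.1 p.2) ^ 2)] at vertical
    simp only [Finset.sum_add_distrib]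
    exact add_le_add (sum_antidiagonal_sq_sub_le_horizontalEnergy Y D) vertical
  rw [← telescope]
  calc _ ≤ (∑ d ∈ Finset.range D, (2 : ℝ) / (d + 1)) * ∑ d ∈ Finset.range D,
          ∑ p ∈ antidiagonal d,
            ((Y (p.1 + 1) p.2 - Y p.1 p.2) ^ 2 + (Y p.1 (p.2 + 1) - Y p.1 p.2) ^ 2) :=
        Finset.sum_sq_le_sum_mul_sum_of_sq_le_mul _ (fun d _ => by positivity)
          (fun _ _ => Finset.sum_nonneg fun _ _ => by positivity)
          (fun d _ => sq_expect_antidiagonal_succ_sub_le Y d)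
    _ ≤ 2 * (1 + Real.log D) * latticeEnergy D Y :=
        mul_le_mul (sum_two_div_le D) triangle_le
          (Finset.sum_nonneg fun _ _ => Finset.sum_nonneg fun _ _ => by positivity)
          (by have := Real.log_natCast_nonneg D; positivity)

/-- The average of row `j` of the square lattice `{0, …, K}²`. -/
noncomputable def rowAverage (K : ℕ) (X : ℕ → ℕ → ℝ) (j : ℕ) : ℝ :=
  𝔼 i ∈ Finset.range (K + 1), X i j

lemma sq_rowAverage_sub_le {K j j' : ℕ} (X : ℕ → ℕ → ℝ) (hj : j ≤ K) (hj' : j' ≤ K) :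
    (rowAverage K X j - rowAverage K X j') ^ 2 ≤ horizontalEnergy K (Function.swap X) := by
  set W := horizontalEnergy K (Function.swap X)
  have W_nonneg : 0 ≤ W := horizontalEnergy_nonneg K _
  have pathEnergy_le : pathEnergy K (rowAverage K X) ≤ W / (K + 1) := by
    refine (pathEnergy_expect_le (Finset.range (K + 1)) K X).trans_eq ?_
    rw [Finset.expect_eq_sum_div_card, Finset.card_range, Nat.cast_succ]
    rfl
  calc _ ≤ (K : ℝ) * pathEnergy K (rowAverage K X) :=
        sq_sub_le_pathEnergy hj hj' (by omega) (by omega)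
    _ ≤ K * (W / (K + 1)) := by gcongr
    _ = W * (K / (K + 1)) := by ring
    _ ≤ W := mul_le_of_le_one_right W_nonneg ((div_le_one (by positivity)).2 (by linarith))

lemma sq_sub_rowAverage_le {K i : ℕ} (X : ℕ → ℕ → ℝ) (j : ℕ) (hi : i ≤ K) :
    (X i j - rowAverage K X j) ^ 2 ≤ K * pathEnergy K fun i => X i j := by
  rw [sub_sq_comm]
  refine (sq_expect_sub_le (by simp) _ _).trans (Finset.expect_le (by simp) fun i' hi' => ?_)
  have := Finset.mem_range.1 hi'
  exact sq_sub_le_pathEnergy (Z := fun i => X i j) (by omega) hi (by omega) (by omega)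

lemma sq_expect_antidiagonal_sub_rowAverage_le {K D : ℕ} {f g : ℕ → ℕ} (X : ℕ → ℕ → ℝ)
    (hKD : K ≤ 2 * (D + 1))
    (hf : Set.MapsTo f (Finset.range (D + 1)) (Finset.range (K + 1)))
    (hg : Set.InjOn g (Finset.range (D + 1)))
    (hgK : Set.MapsTo g (Finset.range (D + 1)) (Finset.range (K + 1))) :
    (𝔼 p ∈ antidiagonal D, X (f p.1) (g p.2) - rowAverage K X 0) ^ 2 ≤ 4 * latticeEnergy K X := by
  set W := horizontalEnergy K (Function.swap X)
  have hD : (0 : ℝ) < D + 1 := by positivity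
  have point_le : ∀ p ∈ antidiagonal D, (X (f p.1) (g p.2) - rowAverage K X 0) ^ 2 ≤
      2 * K * (pathEnergy K fun i => X i (g p.2)) + 2 * W := fun p hp => by
    have := mem_antidiagonal.1 hp
    have hf' := hf (Finset.mem_coe.2 (Finset.mem_range.2 (show p.1 < D + 1 by omega)))
    have hg' := hgK (Finset.mem_coe.2 (Finset.mem_range.2 (show p.2 < D + 1 by omega)))
    simp only [Finset.coe_range, Set.mem_Iio, Nat.lt_succ_iff] at hf' hg'
    have row := sq_sub_rowAverage_le X (g p.2) hf'
    have rows := sq_rowAverage_sub_le X hg' (Nat.zero_le K)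
    rw [← sub_add_sub_cancel _ (rowAverage K X (g p.2))]
    exact add_sq_le.trans (by linarith)
  have sum_snd : ∑ p ∈ antidiagonal D, (pathEnergy K fun i => X i (g p.2)) =
      ∑ j ∈ Finset.range (D + 1), pathEnergy K fun i => X i (g j) := by
    rw [← Finset.Nat.sum_antidiagonal_swap]
    exact Finset.Nat.sum_antidiagonal_eq_sum_range_succ
      (fun j _ => pathEnergy K fun i => X i (g j)) D
  calc _ ≤ 𝔼 p ∈ antidiagonal D, (2 * K * (pathEnergy K fun i => X i (g p.2)) + 2 * W) :=
        (sq_expect_sub_le (Finset.card_pos.1 (by simp)) _ _).trans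
          (Finset.expect_le_expect point_le)
    _ = 2 * (K / (D + 1)) * (∑ j ∈ Finset.range (D + 1), pathEnergy K fun i => X i (g j)) +
          2 * W := by
        rw [Finset.expect_add_distrib, Finset.expect_const (Finset.card_pos.1 (by simp)),
          ← Finset.mul_expect, Finset.expect_eq_sum_div_card, sum_snd, Finset.Nat.card_antidiagonal]
        push_cast
        ring
    _ ≤ 2 * 2 * horizontalEnergy K X + 4 * W := by
        have hratio : (K : ℝ) / (D + 1) ≤ 2 := by
          rw [div_le_iff₀ hD]
          exact_mod_cast hKD
        have := horizontalEnergy_nonneg K (Function.swap X)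
        have := sum_pathEnergy_comp_le X hg hgK
        have : 0 ≤ ∑ j ∈ Finset.range (D + 1), pathEnergy K fun i => X i (g j) :=
          Finset.sum_nonneg fun _ _ => pathEnergy_nonneg K _
        gcongr
        norm_num
    _ = 4 * latticeEnergy K X := by rw [latticeEnergy]; ring

/-- Every node is a corner of a square of side `K / 2`, and the growing antidiagonals of that square
spread a unit current out of it. -/
lemma sq_sub_rowAverage_zero_le {K k₁ k₂ : ℕ} (X : ℕ → ℕ → ℝ) (h₁ : k₁ ≤ K) (h₂ : k₂ ≤ K) :
    (X k₁ k₂ - rowAverage K X 0) ^ 2 ≤ (12 + 4 * Real.log (K + 1)) * latticeEnergy K X := by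
  obtain ⟨f, rfl, hf, finj, hfZ⟩ := exists_straight_walk h₁
  obtain ⟨g, rfl, hg, ginj, hgZ⟩ := exists_straight_walk h₂
  have square_le : latticeEnergy (K / 2) (fun i j => X (f i) (g j)) ≤ latticeEnergy K X :=
    add_le_add (horizontalEnergy_comp_le X hfZ ginj hg)
      (horizontalEnergy_comp_le (Function.swap X) hgZ finj hf)
  have log_le : Real.log (K / 2 : ℕ) ≤ Real.log (K + 1) := by
    rw [← Nat.cast_succ]
    rcases Nat.eq_zero_or_pos (K / 2) with h | h
    · rw [h, Nat.cast_zero, Real.log_zero]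
      exact Real.log_natCast_nonneg _
    · exact Real.log_le_log (Nat.cast_pos.2 h) (Nat.cast_le.2 (by omega))
  have log_nonneg := Real.log_natCast_nonneg (K / 2)
  have corner : (𝔼 p ∈ antidiagonal (K / 2), X (f p.1) (g p.2) - X (f 0) (g 0)) ^ 2 ≤
      2 * (1 + Real.log (K + 1)) * latticeEnergy K X :=
    (sq_expect_antidiagonal_sub_corner_le (fun i j => X (f i) (g j)) (K / 2)).trans
      (mul_le_mul (by gcongr) square_le (latticeEnergy_nonneg _ _)
        (by linarith))
  have row := sq_expect_antidiagonal_sub_rowAverage_le X (by omega) hf ginj hg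
  rw [sub_sq_comm] at corner
  rw [← sub_add_sub_cancel _ (𝔼 p ∈ antidiagonal (K / 2), X (f p.1) (g p.2))]
  exact add_sq_le.trans (by linarith)

end Lattice

section Blocks

open scoped BigOperators

variable {V : Type*} [LinearOrder V] [Fintype V]

lemma sum_adj_sq_sub (G : SimpleGraph V) [DecidableRel G.Adj] (x : V → ℝ) :
    ∑ p : V × V with G.Adj p.1 p.2, (x p.1 - x p.2) ^ 2 = 2 * energy (edgeDiff G) x := by
  have sum_lt : ∑ p : V × V with G.Adj p.1 p.2 ∧ p.1 < p.2, (x p.1 - x p.2) ^ 2 =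
      energy (edgeDiff G) x := by
    simp only [energy, edgeDiff_apply]
    exact Finset.sum_subtype _ (fun p => by rw [Finset.mem_filter_univ])
      fun p : V × V => (x p.1 - x p.2) ^ 2
  have sum_gt : ∑ p : V × V with G.Adj p.1 p.2 ∧ ¬p.1 < p.2, (x p.1 - x p.2) ^ 2 =
      energy (edgeDiff G) x := by
    rw [← sum_lt]
    refine Finset.sum_equiv (Equiv.prodComm V V) (fun p => ?_) fun p _ => sub_sq_comm _ _
    simp only [Finset.mem_filter_univ, Equiv.prodComm_apply, Prod.fst_swap, Prod.snd_swap, not_lt]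
    exact ⟨fun h => ⟨h.1.symm, h.2.lt_of_ne h.1.ne'⟩, fun h => ⟨h.1.symm, h.2.le⟩⟩
  rw [← Finset.sum_filter_add_sum_filter_not _ fun p : V × V => p.1 < p.2, Finset.filter_filter,
    Finset.filter_filter, sum_lt, sum_gt, two_mul]

lemma sum_sq_sub_le_energy (G : SimpleGraph V) (x : V → ℝ) {α : Type*} {A : Finset α}
    {f g : α → V} (hinj : Set.InjOn (fun a => (f a, g a)) A)
    (hadj : ∀ a ∈ A, f a = g a ∨ G.Adj (f a) (g a)) :
    ∑ a ∈ A, (x (f a) - x (g a)) ^ 2 ≤ 2 * energy (edgeDiff G) x := by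
  classical
  have sum_ne : ∑ a ∈ A with f a ≠ g a, (x (f a) - x (g a)) ^ 2 =
      ∑ a ∈ A, (x (f a) - x (g a)) ^ 2 :=
    Finset.sum_filter_of_ne fun a _ ha h => ha (by rw [h, sub_self, zero_pow two_ne_zero])
  rw [← sum_ne, ← sum_adj_sq_sub]
  refine sum_comp_le_of_injOn (F := fun p : V × V => (x p.1 - x p.2) ^ 2)
    (hinj.mono (Finset.coe_subset.2 (Finset.filter_subset _ A))) (fun a ha => ?_)
    fun _ _ => sq_nonneg _
  obtain ⟨ha, hne⟩ := Finset.mem_filter.1 (Finset.mem_coe.1 ha)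
  exact Finset.mem_coe.2 (Finset.mem_filter_univ _ |>.2 ((hadj a ha).resolve_left hne))

variable {B U : Type*} [Fintype U]

/-- The average of `x` over the block `b`, whose points are `φ b u`. -/
noncomputable def blockAverage {V : Type*} (φ : B → U → V) (x : V → ℝ) (b : B) : ℝ :=
  𝔼 u, x (φ b u)

lemma sq_blockAverage_sub_le [Nonempty U] (G : SimpleGraph V) (φ : B → U → V) (x : V → ℝ) {k : V}
    {b : B} (hinj : Function.Injective (φ b)) (hadj : ∀ u, φ b u = k ∨ G.Adj (φ b u) k) :
    (blockAverage φ x b - x k) ^ 2 ≤ 2 * energy (edgeDiff G) x / Fintype.card U := by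
  refine (sq_expect_sub_le Finset.univ_nonempty _ _).trans ?_
  rw [Finset.expect_eq_sum_div_card, Finset.card_univ]
  gcongr
  exact sum_sq_sub_le_energy G x (fun u _ v _ h => hinj (Prod.mk.inj h).1) fun u _ => hadj u

lemma sum_sq_blockAverage_sub_le [Nonempty U] (G : SimpleGraph V) (φ : B → U → V) (x : V → ℝ)
    {α : Type*} {A : Finset α} {b b' : α → B}
    (hinj : ∀ a ∈ A, ∀ a' ∈ A, ∀ u u' v v', φ (b a) u = φ (b a') u' → φ (b' a) v = φ (b' a') v' →
      a = a' ∧ u = u' ∧ v = v')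
    (hadj : ∀ a ∈ A, ∀ u v, φ (b a) u = φ (b' a) v ∨ G.Adj (φ (b a) u) (φ (b' a) v)) :
    ∑ a ∈ A, (blockAverage φ x (b a) - blockAverage φ x (b' a)) ^ 2 ≤
      2 * energy (edgeDiff G) x / (Fintype.card U : ℝ) ^ 2 := by
  calc _ ≤ ∑ a ∈ A, 𝔼 u, 𝔼 v, (x (φ (b a) u) - x (φ (b' a) v)) ^ 2 :=
        Finset.sum_le_sum fun a _ =>
          sq_expect_sub_expect_le Finset.univ_nonempty Finset.univ_nonempty _ _
    _ = (∑ q ∈ A ×ˢ (Finset.univ : Finset (U × U)),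
          (x (φ (b q.1) q.2.1) - x (φ (b' q.1) q.2.2)) ^ 2) / (Fintype.card U : ℝ) ^ 2 := by
        simp only [Finset.expect_eq_sum_div_card, Finset.card_univ, ← Finset.sum_div,
          Finset.sum_product, Fintype.sum_prod_type, div_div, ← sq]
    _ ≤ _ := by
        gcongr
        refine sum_sq_sub_le_energy G x ?_ fun q hq => hadj q.1 (Finset.mem_product.1 hq).1 _ _
        rintro ⟨a, u, v⟩ ha ⟨a', u', v'⟩ ha' h
        obtain ⟨rfl, rfl, rfl⟩ := hinj a (Finset.mem_product.1 ha).1 a' (Finset.mem_product.1 ha').1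
          u u' v v' (Prod.mk.inj h).1 (Prod.mk.inj h).2
        rfl

lemma sq_sub_le_of_three {a b c d α β : ℝ} (hab : (b - a) ^ 2 ≤ α) (hbc : (b - c) ^ 2 ≤ β)
    (hcd : (c - d) ^ 2 ≤ α) : (a - d) ^ 2 ≤ 6 * α + 3 * β := by
  nlinarith [sq_nonneg ((b - a) + (b - c)), sq_nonneg ((b - c) - (c - d)),
    sq_nonneg ((b - a) + (c - d))]

end Blocks

section Division

/-- The position `u` of the block of length `h` with index `a`. The blocks `0, …, n / h - 1` lie in
`Fin n`; other indices wrap around. -/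
def blockPoint (n : ℕ) [NeZero n] {h : ℕ} (a : ℕ) (u : Fin h) : Fin n := Fin.ofNat n (a * h + u)

/-- The index of a block near `i`, among blocks `0, …, n / h - 1`. The last `n % h` points, which
form no full block, are assigned to the last block. -/
def blockIndex (n h : ℕ) (i : Fin n) : ℕ := min (i / h) (n / h - 1)

lemma blockIndex_lt {n h : ℕ} (hh : 0 < h) (hn : h ≤ n) (i : Fin n) :
    blockIndex n h i < n / h := by
  have := Nat.div_pos hn hh
  simp only [blockIndex]
  omega

lemma blockIndex_le_add {n h : ℕ} {i j : Fin n} {c : ℕ} (hh : 0 < h)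
    (hij : (j : ℕ) ≤ i + c * h) : blockIndex n h j ≤ blockIndex n h i + c := by
  have div_le := Nat.div_le_div_right (c := h) hij
  rw [Nat.add_mul_div_right _ _ hh] at div_le
  simp only [blockIndex]
  omega

lemma blockIndex_mul_le (n h : ℕ) (i : Fin n) : blockIndex n h i * h ≤ i :=
  (Nat.mul_le_mul_right h (min_le_left _ _)).trans (Nat.div_mul_le_self _ _)

lemma lt_blockIndex_add_two_mul {n h : ℕ} (hh : 0 < h) (hn : h ≤ n) (i : Fin n) :
    (i : ℕ) + 1 < (blockIndex n h i + 2) * h := by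
  have lt_index := Nat.lt_mul_of_div_lt (Nat.lt_succ_self ((i : ℕ) / h)) hh
  have lt_last := Nat.lt_mul_of_div_lt (Nat.lt_succ_self (n / h)) hh
  have := Nat.div_pos hn hh
  rcases le_total ((i : ℕ) / h) (n / h - 1) with hle | hle
  · rw [blockIndex, min_eq_left hle]
    linarith
  · rw [blockIndex, min_eq_right hle, show n / h - 1 + 2 = (n / h).succ by omega]
    linarith [i.2]

variable {n h : ℕ} [NeZero n]

lemma blockPoint_val {a : ℕ} (u : Fin h) (ha : a < n / h) :
    (blockPoint n a u : ℕ) = a * h + u := by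
  refine Nat.mod_eq_of_lt ?_
  have block_le := Nat.mul_le_mul_right h (Nat.succ_le_of_lt ha)
  rw [Nat.succ_mul] at block_le
  linarith [Nat.div_mul_le_self n h, u.2]

lemma blockPoint_inj {a a' : ℕ} {u u' : Fin h} (ha : a < n / h) (ha' : a' < n / h)
    (heq : blockPoint n a u = blockPoint n a' u') : a = a' ∧ u = u' := by
  have val_eq := congrArg Fin.val heq
  rw [blockPoint_val u ha, blockPoint_val u' ha'] at val_eq
  have index : ∀ (b : ℕ) (v : Fin h), (b * h + v) / h = b := fun b v => by
    rw [add_comm, Nat.add_mul_div_right _ _ v.pos, Nat.div_eq_of_lt v.2, zero_add]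
  obtain rfl : a = a' := by rw [← index a u, val_eq, index]
  exact ⟨rfl, Fin.ext (Nat.add_left_cancel val_eq)⟩

lemma abs_blockPoint_sub_le (hh : 0 < h) (hn : h ≤ n) (i : Fin n) (u : Fin h) :
    |((blockPoint n (blockIndex n h i) u : ℕ) : ℤ) - (i : ℕ)| ≤ 2 * h - 2 := by
  have start_le := blockIndex_mul_le n h i
  have lt_end := lt_blockIndex_add_two_mul hh hn i
  rw [blockPoint_val u (blockIndex_lt hh hn i), abs_le]
  rw [add_mul] at lt_end
  omega

lemma abs_blockPoint_sub_same_le {a : ℕ} (ha : a < n / h) (u v : Fin h) :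
    |((blockPoint n a u : ℕ) : ℤ) - (blockPoint n a v : ℕ)| ≤ h - 1 := by
  rw [blockPoint_val u ha, blockPoint_val v ha, abs_le]
  omega

lemma abs_blockPoint_succ_sub_le {a : ℕ} (ha : a + 1 < n / h) (u v : Fin h) :
    |((blockPoint n (a + 1) u : ℕ) : ℤ) - (blockPoint n a v : ℕ)| ≤ 2 * h - 1 := by
  rw [blockPoint_val u ha, blockPoint_val v (Nat.lt_of_succ_lt ha), abs_le, Nat.succ_mul]
  omega

end Division

section OneDimensional

lemma grid1D_eq_or_adj {n r : ℕ} {i j : Fin n} (h : |((i : ℕ) : ℤ) - (j : ℕ)| ≤ r) :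
    i = j ∨ (grid1D n r).Adj i j :=
  or_iff_not_imp_left.2 fun hne => ⟨hne, h⟩

lemma pathEnergy_blockAverage_le {n r h : ℕ} [NeZero n] (hh : 0 < h) (hn : h ≤ n)
    (hhr : 2 * h ≤ r + 1) (x : Fin n → ℝ) :
    pathEnergy (n / h - 1) (blockAverage (fun a (u : Fin h) => blockPoint n a u) x) ≤
      2 * energy (edgeDiff (grid1D n r)) x / (h : ℝ) ^ 2 := by
  have : Nonempty (Fin h) := ⟨⟨0, hh⟩⟩
  have := Nat.div_pos hn hh
  refine (sum_sq_blockAverage_sub_le (grid1D n r) _ x (b := fun a => a + 1) (b' := fun a => a)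
    ?_ ?_).trans_eq (by rw [Fintype.card_fin])
  · intro a ha a' ha' u u' v v' hu hv
    rw [Finset.mem_range] at ha ha'
    exact ⟨(blockPoint_inj (by omega) (by omega) hv).1, (blockPoint_inj (by omega) (by omega) hu).2,
      (blockPoint_inj (by omega) (by omega) hv).2⟩
  · intro a ha u v
    rw [Finset.mem_range] at ha
    exact grid1D_eq_or_adj ((abs_blockPoint_succ_sub_le (by omega) u v).trans (by omega))

lemma resistanceLE_grid1D_of_blockIndex {n r h d : ℕ} (hh : 0 < h) (hn : h ≤ n)
    (hhr : 2 * h ≤ r + 1) {k l : Fin n} (hkl : blockIndex n h k ≤ blockIndex n h l + d)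
    (hlk : blockIndex n h l ≤ blockIndex n h k + d) :
    ResistanceLE (grid1D n r) k l (12 / h + 6 * d / (h : ℝ) ^ 2) := fun x => by
  have : NeZero n := ⟨by omega⟩
  have : Nonempty (Fin h) := ⟨⟨0, hh⟩⟩
  set Z := blockAverage (fun a (u : Fin h) => blockPoint n a u) x
  set E := energy (edgeDiff (grid1D n r)) x
  have local_le : ∀ i : Fin n, (Z (blockIndex n h i) - x i) ^ 2 ≤ 2 * E / h := fun i => by
    have hi := blockIndex_lt hh hn i
    simpa only [Fintype.card_fin] using sq_blockAverage_sub_le (grid1D n r)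
      (fun a (u : Fin h) => blockPoint n a u) x (fun u v huv => (blockPoint_inj hi hi huv).2)
      fun u => grid1D_eq_or_adj ((abs_blockPoint_sub_le hh hn i u).trans (by omega))
  have coarse_le : (Z (blockIndex n h k) - Z (blockIndex n h l)) ^ 2 ≤ d * (2 * E / (h : ℝ) ^ 2) :=
    (sq_sub_le_pathEnergy (Nat.le_sub_one_of_lt (blockIndex_lt hh hn k))
      (Nat.le_sub_one_of_lt (blockIndex_lt hh hn l)) hkl hlk).trans
      (mul_le_mul_of_nonneg_left (pathEnergy_blockAverage_le hh hn hhr x) (Nat.cast_nonneg d))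
  exact (sq_sub_le_of_three (local_le k) coarse_le (local_le l)).trans_eq (by ring)

lemma resistanceLE_grid1D_of_adj {n r : ℕ} (hr : 1 ≤ r) (hrn : r ≤ n) {k l : Fin n}
    (hkl : (grid1D n r).Adj k l) : ResistanceLE (grid1D n r) k l (48 / r) := by
  have dist_le := abs_le.1 hkl.2
  obtain ⟨h, hh, hhr, hrh⟩ : ∃ h, 0 < h ∧ 2 * h ≤ r + 1 ∧ r ≤ 2 * h :=
    ⟨(r + 1) / 2, by omega, by omega, by omega⟩
  refine (resistanceLE_grid1D_of_blockIndex (d := 2) hh (by omega) hhr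
    (blockIndex_le_add hh (by omega)) (blockIndex_le_add hh (by omega))).mono ?_
  have one_le : (1 : ℝ) ≤ h := by exact_mod_cast hh
  have : (0 : ℝ) < r := by exact_mod_cast hr
  have half_le : (r : ℝ) / 2 ≤ h := by
    rw [div_le_iff₀' two_pos]
    exact_mod_cast hrh
  calc (12 : ℝ) / h + 6 * (2 : ℕ) / (h : ℝ) ^ 2 ≤ 12 / h + 6 * (2 : ℕ) / h := by
        gcongr
        exact le_self_pow₀ one_le two_ne_zero
    _ = 24 / h := by push_cast; ring
    _ ≤ 24 / (r / 2) := by gcongr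
    _ = 48 / r := by ring

lemma resistanceLE_grid1D {n r : ℕ} (hr : 1 ≤ r) (hrn : r ≤ n) (k l : Fin n) :
    ResistanceLE (grid1D n r) k l (48 * ((n : ℝ) / (r : ℝ) ^ 2 + 1) / r) := by
  obtain ⟨h, hh, hhr, hrh⟩ : ∃ h, 0 < h ∧ 2 * h ≤ r + 1 ∧ r ≤ 2 * h :=
    ⟨(r + 1) / 2, by omega, by omega, by omega⟩
  have hhn : h ≤ n := by omega
  have := blockIndex_lt hh hhn k
  have := blockIndex_lt hh hhn l
  refine (resistanceLE_grid1D_of_blockIndex (d := n / h) hh hhn hhr (by omega) (by omega)).mono ?_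
  have : (0 : ℝ) < r := by exact_mod_cast hr
  have half_le : (r : ℝ) / 2 ≤ h := by
    rw [div_le_iff₀' two_pos]
    exact_mod_cast hrh
  have : (0 : ℝ) < h := by exact_mod_cast hh
  have div_le : ((n / h : ℕ) : ℝ) ≤ n / h := Nat.cast_div_le
  calc (12 : ℝ) / h + 6 * (n / h : ℕ) / (h : ℝ) ^ 2 ≤ 12 / h + 6 * (n / h) / (h : ℝ) ^ 2 := by
        gcongr
    _ = 12 / h + 6 * n / (h : ℝ) ^ 3 := by field_simp
    _ ≤ 12 / (r / 2) + 6 * n / (r / 2 : ℝ) ^ 3 := by gcongr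
    _ = 48 * ((n : ℝ) / (r : ℝ) ^ 2 + 1) / r - 24 / r := by field_simp; ring
    _ ≤ _ := sub_le_self _ (by positivity)

lemma card_orientedEdge_grid1D_le {n r : ℕ} (hr : 1 ≤ r) :
    Fintype.card (OrientedEdge (grid1D n r)) ≤ 2 * (n * r) := by
  have le_offset : Fintype.card (OrientedEdge (grid1D n r)) ≤
      Fintype.card (Fin n × Fin (r + 1)) := by
    refine Fintype.card_le_of_injective (fun e => (e.1.1, ⟨(e.1.2 : ℕ) - e.1.1, ?_⟩)) ?_
    · have := abs_le.1 e.2.1.2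
      omega
    · rintro ⟨⟨i, j⟩, _, hij⟩ ⟨⟨i', j'⟩, _, hij'⟩ heq
      obtain ⟨rfl, offset_eq⟩ := Prod.mk.inj heq
      have val_eq : (j : ℕ) - i = j' - i := Fin.mk.inj offset_eq
      have hij : (i : ℕ) < j := hij
      have hij' : (i : ℕ) < j' := hij'
      obtain rfl : j = j' := Fin.ext (by omega)
      rfl
  rw [Fintype.card_prod, Fintype.card_fin, Fintype.card_fin] at le_offset
  nlinarith

end OneDimensional

section TwoDimensional

lemma grid2D_eq_or_adj {m r : ℕ} {i j : Fin m ×ₗ Fin m} {c d : ℤ}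
    (h₁ : |(((ofLex i).1 : ℕ) : ℤ) - ((ofLex j).1 : ℕ)| ≤ c)
    (h₂ : |(((ofLex i).2 : ℕ) : ℤ) - ((ofLex j).2 : ℕ)| ≤ d) (hr : c + d ≤ r) :
    i = j ∨ (grid2D m r).Adj i j :=
  or_iff_not_imp_left.2 fun hne => ⟨hne, (add_le_add h₁ h₂).trans hr⟩

lemma abs_sub_le_of_grid2D_adj {m r : ℕ} {i j : Fin m ×ₗ Fin m} (h : (grid2D m r).Adj i j) :
    |(((ofLex i).1 : ℕ) : ℤ) - ((ofLex j).1 : ℕ)| ≤ r ∧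
      |(((ofLex i).2 : ℕ) : ℤ) - ((ofLex j).2 : ℕ)| ≤ r :=
  ⟨(le_add_of_nonneg_right (abs_nonneg _)).trans h.2,
    (le_add_of_nonneg_left (abs_nonneg _)).trans h.2⟩

/-- The points of the square block with index `a`. -/
def squareBlockPoint (m : ℕ) [NeZero m] {h : ℕ} (a : ℕ × ℕ) (u : Fin h × Fin h) :
    Fin m ×ₗ Fin m :=
  toLex (blockPoint m a.1 u.1, blockPoint m a.2 u.2)

/-- The average of `x` over the square block `(a, b)` of side `h`. -/
noncomputable def squareAverage (m h : ℕ) [NeZero m] (x : Fin m ×ₗ Fin m → ℝ) (a b : ℕ) : ℝ :=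
  blockAverage (squareBlockPoint m (h := h)) x (a, b)

section Square

variable {m r h : ℕ} [NeZero m]

lemma squareBlockPoint_inj {a a' : ℕ × ℕ} {u u' : Fin h × Fin h} (h₁ : a.1 < m / h)
    (h₂ : a.2 < m / h) (h₁' : a'.1 < m / h) (h₂' : a'.2 < m / h)
    (heq : squareBlockPoint m a u = squareBlockPoint m a' u') : a = a' ∧ u = u' := by
  obtain ⟨heq₁, heq₂⟩ := Prod.mk.inj (toLex.injective heq)
  obtain ⟨ha₁, hu₁⟩ := blockPoint_inj h₁ h₁' heq₁
  obtain ⟨ha₂, hu₂⟩ := blockPoint_inj h₂ h₂' heq₂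
  exact ⟨Prod.ext ha₁ ha₂, Prod.ext hu₁ hu₂⟩

lemma sq_squareAverage_sub_le (hh : 0 < h) (hm : h ≤ m) (hhr : 4 * h ≤ r + 4)
    (x : Fin m ×ₗ Fin m → ℝ) (i : Fin m ×ₗ Fin m) :
    (squareAverage m h x (blockIndex m h (ofLex i).1) (blockIndex m h (ofLex i).2) - x i) ^ 2 ≤
      2 * energy (edgeDiff (grid2D m r)) x / (h : ℝ) ^ 2 := by
  have : Nonempty (Fin h) := ⟨⟨0, hh⟩⟩
  have h₁ := blockIndex_lt hh hm (ofLex i).1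
  have h₂ := blockIndex_lt hh hm (ofLex i).2
  refine (sq_blockAverage_sub_le (grid2D m r) (squareBlockPoint m (h := h)) x (k := i)
    (b := (blockIndex m h (ofLex i).1, blockIndex m h (ofLex i).2))
    (fun u v huv => (squareBlockPoint_inj h₁ h₂ h₁ h₂ huv).2)
    (fun u => grid2D_eq_or_adj (abs_blockPoint_sub_le hh hm (ofLex i).1 u.1)
      (abs_blockPoint_sub_le hh hm (ofLex i).2 u.2) (by omega))).trans_eq ?_
  rw [Fintype.card_prod, Fintype.card_fin, Nat.cast_mul, ← sq]

lemma sum_sq_squareAverage_sub_le (hh : 0 < h) (hhr : 3 * h ≤ r + 2) (x : Fin m ×ₗ Fin m → ℝ)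
    {A : Finset (ℕ × ℕ)} {s : ℕ × ℕ → ℕ × ℕ}
    (hs : s = Prod.map Nat.succ id ∨ s = Prod.map id Nat.succ)
    (hA : ∀ a ∈ A, (s a).1 < m / h ∧ (s a).2 < m / h) :
    ∑ a ∈ A, (squareAverage m h x (s a).1 (s a).2 - squareAverage m h x a.1 a.2) ^ 2 ≤
      2 * energy (edgeDiff (grid2D m r)) x / (h : ℝ) ^ 4 := by
  have : Nonempty (Fin h) := ⟨⟨0, hh⟩⟩
  have le_s : ∀ a, a.1 ≤ (s a).1 ∧ a.2 ≤ (s a).2 := fun a => by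
    rcases hs with rfl | rfl <;> simp
  refine (sum_sq_blockAverage_sub_le (grid2D m r) (squareBlockPoint m (h := h)) x (A := A)
    (b := s) (b' := id) (fun a ha a' ha' u u' v v' hu hv => ?_) fun a ha u v => ?_).trans_eq ?_
  · have index_lt : ∀ a ∈ A, a.1 < m / h ∧ a.2 < m / h := fun a ha =>
      ⟨(le_s a).1.trans_lt (hA a ha).1, (le_s a).2.trans_lt (hA a ha).2⟩
    have hu' := squareBlockPoint_inj (hA a ha).1 (hA a ha).2 (hA a' ha').1 (hA a' ha').2 hu
    have hv' := squareBlockPoint_inj (index_lt a ha).1 (index_lt a ha).2 (index_lt a' ha').1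
      (index_lt a' ha').2 hv
    exact ⟨hv'.1, hu'.2, hv'.2⟩
  · have := hA a ha
    rcases hs with rfl | rfl
    · exact grid2D_eq_or_adj (abs_blockPoint_succ_sub_le this.1 u.1 v.1)
        (abs_blockPoint_sub_same_le this.2 u.2 v.2) (by omega)
    · exact grid2D_eq_or_adj (abs_blockPoint_sub_same_le this.1 u.1 v.1)
        (abs_blockPoint_succ_sub_le this.2 u.2 v.2) (by omega)
  · rw [Fintype.card_prod, Fintype.card_fin, Nat.cast_mul, ← sq, ← pow_mul]

lemma latticeEnergy_squareAverage_le (hh : 0 < h) (hm : h ≤ m) (hhr : 3 * h ≤ r + 2)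
    (x : Fin m ×ₗ Fin m → ℝ) :
    latticeEnergy (m / h - 1) (squareAverage m h x) ≤
      4 * energy (edgeDiff (grid2D m r)) x / (h : ℝ) ^ 4 := by
  have := Nat.div_pos hm hh
  have horizontal := sum_sq_squareAverage_sub_le hh hhr x
    (A := Finset.range (m / h - 1) ×ˢ Finset.range (m / h - 1 + 1)) (.inl rfl)
    fun a ha => by
      simp only [Finset.mem_product, Finset.mem_range, Prod.map_fst, Prod.map_snd, id] at ha ⊢
      omega
  have vertical := sum_sq_squareAverage_sub_le hh hhr x
    (A := Finset.range (m / h - 1 + 1) ×ˢ Finset.range (m / h - 1)) (.inr rfl)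
    fun a ha => by
      simp only [Finset.mem_product, Finset.mem_range, Prod.map_fst, Prod.map_snd, id] at ha ⊢
      omega
  rw [Finset.sum_product_right] at horizontal
  rw [Finset.sum_product] at vertical
  exact (add_le_add horizontal vertical).trans_eq (by ring)

end Square

variable {m r : ℕ} {k l : Fin m ×ₗ Fin m}

/-- The blocks have side `h = r / 4 + 1`, which is comparable to `r`, yet so small that points of
neighbouring blocks are adjacent. -/
lemma resistanceLE_grid2D_of_coarse (hr : 1 ≤ r) (hrm : r ≤ 2 * m) {ρ : ℝ} (hρ : 0 ≤ ρ)
    (hcoarse : ∀ X : ℕ → ℕ → ℝ,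
      (X (blockIndex m (r / 4 + 1) (ofLex k).1) (blockIndex m (r / 4 + 1) (ofLex k).2) -
        X (blockIndex m (r / 4 + 1) (ofLex l).1) (blockIndex m (r / 4 + 1) (ofLex l).2)) ^ 2 ≤
        ρ * latticeEnergy (m / (r / 4 + 1) - 1) X) :
    ResistanceLE (grid2D m r) k l (192 * (1 + 16 * ρ / (r : ℝ) ^ 2) / (r : ℝ) ^ 2) := fun x => by
  have : NeZero m := ⟨by omega⟩
  obtain ⟨h, hh⟩ : ∃ h, h = r / 4 + 1 := ⟨_, rfl⟩
  rw [← hh] at hcoarse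
  set E := energy (edgeDiff (grid2D m r)) x
  have E_nonneg : 0 ≤ E := energy_nonneg _ _
  have coarse_le := (hcoarse (squareAverage m h x)).trans (mul_le_mul_of_nonneg_left
    (latticeEnergy_squareAverage_le (r := r) (by omega) (by omega) (by omega) x) hρ)
  have local_le := sq_squareAverage_sub_le (h := h) (r := r) (by omega) (by omega) (by omega) x
  have : (0 : ℝ) < r := by exact_mod_cast hr
  have quarter_le : (r : ℝ) / 4 ≤ h := by
    rw [div_le_iff₀' four_pos]
    exact_mod_cast (by omega : r ≤ 4 * h)
  calc (x k - x l) ^ 2 ≤ 6 * (2 * E / (h : ℝ) ^ 2) + 3 * (ρ * (4 * E / (h : ℝ) ^ 4)) :=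
        sq_sub_le_of_three (local_le k) coarse_le (local_le l)
    _ ≤ 6 * (2 * E / (r / 4 : ℝ) ^ 2) + 3 * (ρ * (4 * E / (r / 4 : ℝ) ^ 4)) := by gcongr
    _ = _ := by
        field_simp
        ring

lemma resistanceLE_grid2D_of_adj (hr : 1 ≤ r) (hrm : r ≤ 2 * m) (hkl : (grid2D m r).Adj k l) :
    ResistanceLE (grid2D m r) k l (24768 / (r : ℝ) ^ 2) := by
  have hh : 0 < r / 4 + 1 := Nat.succ_pos _
  have hm : r / 4 + 1 ≤ m := by omega
  have dist_le := abs_sub_le_of_grid2D_adj hkl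
  rw [abs_le, abs_le] at dist_le
  have index_le := fun i => Nat.le_sub_one_of_lt (blockIndex_lt hh hm i)
  refine (resistanceLE_grid2D_of_coarse (ρ := 8) hr hrm (by norm_num) fun X => ?_).mono ?_
  · have row := (sq_sub_le_pathEnergy (d := 4)
      (Z := fun i => X i (blockIndex m (r / 4 + 1) (ofLex k).2)) (index_le (ofLex k).1)
      (index_le (ofLex l).1) (blockIndex_le_add hh (by omega)) (blockIndex_le_add hh (by omega)))
    have column := (sq_sub_le_pathEnergy (d := 4)
      (Z := X (blockIndex m (r / 4 + 1) (ofLex l).1)) (index_le (ofLex k).2)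
      (index_le (ofLex l).2) (blockIndex_le_add hh (by omega)) (blockIndex_le_add hh (by omega)))
    have row_le := pathEnergy_le_horizontalEnergy X (index_le (ofLex k).2)
    have column_le := pathEnergy_le_horizontalEnergy (Function.swap X) (index_le (ofLex l).1)
    rw [← sub_add_sub_cancel _ (X (blockIndex m (r / 4 + 1) (ofLex l).1)
      (blockIndex m (r / 4 + 1) (ofLex k).2)), latticeEnergy]
    push_cast at row column
    exact add_sq_le.trans (by linarith)
  · have one_le : (1 : ℝ) ≤ (r : ℝ) ^ 2 := one_le_pow₀ (by exact_mod_cast hr)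
    calc (192 : ℝ) * (1 + 16 * 8 / (r : ℝ) ^ 2) / (r : ℝ) ^ 2
        ≤ 192 * (1 + 16 * 8) / (r : ℝ) ^ 2 := by
          gcongr
          exact div_le_self (by norm_num) one_le
      _ = _ := by norm_num

lemma resistanceLE_grid2D (hr : 1 ≤ r) (hrm : r ≤ 2 * m) (k l : Fin m ×ₗ Fin m) :
    ResistanceLE (grid2D m r) k l
      (147648 * (Real.log (m ^ 2 : ℕ) / (r : ℝ) ^ 2 + 1) / (r : ℝ) ^ 2) := by
  have hm : r / 4 + 1 ≤ m := by omega
  have index_le := fun i => Nat.le_sub_one_of_lt (blockIndex_lt (Nat.succ_pos (r / 4)) hm i)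
  have log_nonneg := Real.log_natCast_nonneg (m ^ 2)
  have log_le : Real.log ((m / (r / 4 + 1) - 1 : ℕ) + 1) ≤ Real.log (m ^ 2 : ℕ) := by
    refine Real.log_le_log (by positivity) ?_
    have sub_le : m / (r / 4 + 1) - 1 + 1 ≤ m ^ 2 :=
      (Nat.sub_add_cancel (Nat.div_pos hm (Nat.succ_pos _))).trans_le
        ((Nat.div_le_self m _).trans (Nat.le_self_pow two_ne_zero m))
    exact_mod_cast sub_le
  set lg := Real.log (m ^ 2 : ℕ)
  refine (resistanceLE_grid2D_of_coarse (ρ := 4 * (12 + 4 * lg)) hr hrm (by positivity)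
    fun X => ?_).mono ?_
  · have average_le := fun i : Fin m ×ₗ Fin m =>
      (sq_sub_rowAverage_zero_le X (index_le (ofLex i).1) (index_le (ofLex i).2)).trans
        (mul_le_mul_of_nonneg_right (by gcongr : _ ≤ 12 + 4 * lg) (latticeEnergy_nonneg _ X))
    have hk := average_le k
    have hl := average_le l
    rw [sub_sq_comm] at hl
    rw [← sub_add_sub_cancel _ (rowAverage (m / (r / 4 + 1) - 1) X 0)]
    exact add_sq_le.trans (by linarith)
  · have one_le : (1 : ℝ) ≤ (r : ℝ) ^ 2 := one_le_pow₀ (by exact_mod_cast hr)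
    calc 192 * (1 + 16 * (4 * (12 + 4 * lg)) / (r : ℝ) ^ 2) / (r : ℝ) ^ 2
        = 192 * (1 + 768 / (r : ℝ) ^ 2 + 256 * (lg / (r : ℝ) ^ 2)) / (r : ℝ) ^ 2 := by ring
      _ ≤ 192 * (1 + 768 + 769 * (lg / (r : ℝ) ^ 2)) / (r : ℝ) ^ 2 := by
          gcongr
          · exact div_le_self (by norm_num) one_le
          · norm_num
      _ = _ := by ring

lemma card_orientedEdge_grid2D_le (hr : 1 ≤ r) :
    Fintype.card (OrientedEdge (grid2D m r)) ≤ 9 * (m ^ 2 * r ^ 2) := by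
  have le_offset : Fintype.card (OrientedEdge (grid2D m r)) ≤
      Fintype.card ((Fin m ×ₗ Fin m) × Fin (2 * r + 1) × Fin (2 * r + 1)) := by
    refine Fintype.card_le_of_injective
      (fun e => (e.1.1, ⟨((ofLex e.1.2).1 : ℕ) + r - (ofLex e.1.1).1, ?_⟩,
        ⟨((ofLex e.1.2).2 : ℕ) + r - (ofLex e.1.1).2, ?_⟩)) ?_
    · have := abs_le.1 (abs_sub_le_of_grid2D_adj e.2.1).1
      omega
    · have := abs_le.1 (abs_sub_le_of_grid2D_adj e.2.1).2
      omega
    · rintro ⟨⟨i, j⟩, hij, _⟩ ⟨⟨i', j'⟩, hij', _⟩ heq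
      obtain ⟨rfl, offset_eq⟩ := Prod.mk.inj heq
      obtain ⟨offset_eq₁, offset_eq₂⟩ := Prod.mk.inj offset_eq
      have val_eq₁ : ((ofLex j).1 : ℕ) + r - (ofLex i).1 = (ofLex j').1 + r - (ofLex i).1 :=
        Fin.mk.inj offset_eq₁
      have val_eq₂ : ((ofLex j).2 : ℕ) + r - (ofLex i).2 = (ofLex j').2 + r - (ofLex i).2 :=
        Fin.mk.inj offset_eq₂
      have dist_le := abs_sub_le_of_grid2D_adj (i := i) (j := j) hij
      have dist_le' := abs_sub_le_of_grid2D_adj (i := i) (j := j') hij'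
      rw [abs_le, abs_le] at dist_le dist_le'
      obtain rfl : j = j' :=
        ofLex.injective (Prod.ext (Fin.ext (by omega)) (Fin.ext (by omega)))
      rfl
  rw [Fintype.card_prod, Fintype.card_prod, Fintype.card_fin, Fintype.card_lex, Fintype.card_prod,
    Fintype.card_fin] at le_offset
  calc _ ≤ m * m * (3 * r * (3 * r)) := le_offset.trans (by gcongr <;> omega)
    _ = _ := by ring

end TwoDimensional

section Grids

variable {L : ℕ} {κ δ : ℝ} {Ω : Type*} [MeasurableSpace Ω] {P : Measure Ω}
  [IsProbabilityMeasure P]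

lemma sampleBound_le_sampleBound {C C' : ℝ} {p p' n : ℕ} (hC : 0 ≤ C) (hCC' : C ≤ C')
    (hκ : 1 ≤ κ) (hp : p ≤ p') (hδ : 0 < δ) (hδ1 : δ < 1) :
    C * (κ ^ p * n * Real.log (n / δ)) ≤ C' * (κ ^ p' * n * Real.log (n / δ)) := by
  have log_nonneg : 0 ≤ (n : ℝ) * Real.log (n / δ) := by
    rcases Nat.eq_zero_or_pos n with rfl | hn
    · simp
    · have one_le : (1 : ℝ) ≤ n := by exact_mod_cast hn
      exact mul_nonneg (Nat.cast_nonneg n)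
        (Real.log_nonneg ((one_le_div hδ).2 (hδ1.le.trans one_le)))
  have : 0 ≤ C' := hC.trans hCC'
  have : 0 ≤ κ := zero_le_one.trans hκ
  simp only [mul_assoc]
  gcongr

lemma sampleBound_pos {C : ℝ} {n : ℕ} (hC : 0 < C) (hn : 0 < n) (hκ : 0 < κ) (hδ : 0 < δ)
    (hδ1 : δ < 1) : 0 < C * (κ ^ 4 * n * Real.log (n / δ)) := by
  have one_le : (1 : ℝ) ≤ n := by exact_mod_cast hn
  have : 0 < Real.log (n / δ) := Real.log_pos ((one_lt_div hδ).2 (hδ1.trans_le one_le))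
  positivity

theorem mleErrorLE_grid1D {n r : ℕ} {θs : Fin n → ℝ}
    {y : OrientedEdge (grid1D n r) → Fin L → Ω → ℝ} (hrn : r ≤ n) (hκ : 1 ≤ κ)
    (hstar : ∀ i j, (grid1D n r).Adj i j → |θs i - θs j| ≤ Real.log κ) (hδ : 0 < δ) (hδ1 : δ < 1)
    (hy : IsSample P (grid1D n r) L θs y)
    (hcond : 4096 * 48 ^ 2 * 2 * (κ ^ 4 * n * Real.log (n / δ)) ≤ r * L) :
    MLEErrorLE P (grid1D n r) y θs δ fun _ _ =>
      8 * √48 * (κ * √((n / (r : ℝ) ^ 2 + 1) * (1 / (r * L)) * Real.log (n / δ))) := by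
  rcases Nat.eq_zero_or_pos n with rfl | hn
  · exact mleErrorLE_of_isEmpty θs hδ _
  have : NeZero n := ⟨hn.ne'⟩
  have hr : 1 ≤ r := Nat.cast_pos.1 <| pos_of_mul_pos_left
    ((sampleBound_pos (by norm_num) hn (by linarith) hδ hδ1).trans_le hcond) (Nat.cast_nonneg L)
  have error_le := mleErrorLE_of_local_resistanceLE (a := 48) (c := 2) (q := r)
    (X := n / (r : ℝ) ^ 2 + 1) (by norm_num) (by norm_num) (Nat.cast_nonneg r)
    (le_add_of_nonneg_left (by positivity)) hκ hδ hδ1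
    (by rw [Fintype.card_fin]; exact_mod_cast card_orientedEdge_grid1D_le hr)
    (fun i j => resistanceLE_grid1D_of_adj hr hrn) (resistanceLE_grid1D hr hrn) hstar hy
  simp only [Fintype.card_fin] at error_le
  exact error_le hcond

theorem mleErrorLE_grid2D {m r : ℕ} {θs : Fin m ×ₗ Fin m → ℝ}
    {y : OrientedEdge (grid2D m r) → Fin L → Ω → ℝ} (hrm : r ≤ 2 * m) (hκ : 1 ≤ κ)
    (hstar : ∀ i j, (grid2D m r).Adj i j → |θs i - θs j| ≤ Real.log κ) (hδ : 0 < δ) (hδ1 : δ < 1)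
    (hy : IsSample P (grid2D m r) L θs y)
    (hcond : 4096 * 147648 ^ 2 * 9 * (κ ^ 4 * (m ^ 2 : ℕ) * Real.log ((m ^ 2 : ℕ) / δ)) ≤
      (r : ℝ) ^ 2 * L) :
    MLEErrorLE P (grid2D m r) y θs δ fun _ _ =>
      8 * √147648 * (κ * √((Real.log (m ^ 2 : ℕ) / (r : ℝ) ^ 2 + 1) * (1 / ((r : ℝ) ^ 2 * L)) *
        Real.log ((m ^ 2 : ℕ) / δ))) := by
  rcases Nat.eq_zero_or_pos m with rfl | hm
  · have : IsEmpty (Fin 0 ×ₗ Fin 0) := ⟨fun i => (ofLex i).1.elim0⟩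
    exact mleErrorLE_of_isEmpty θs hδ _
  have : Nonempty (Fin m ×ₗ Fin m) := ⟨toLex (⟨0, hm⟩, ⟨0, hm⟩)⟩
  have card_eq : Fintype.card (Fin m ×ₗ Fin m) = m ^ 2 := by
    rw [Fintype.card_lex, Fintype.card_prod, Fintype.card_fin, sq]
  have rsq_pos : 0 < (r : ℝ) ^ 2 := pos_of_mul_pos_left
    ((sampleBound_pos (by norm_num) (by positivity) (by linarith) hδ hδ1).trans_le hcond)
    (Nat.cast_nonneg L)
  have hr : 1 ≤ r := Nat.cast_pos.1 ((sq_pos_iff.1 rsq_pos).lt_of_le' (Nat.cast_nonneg r))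
  have := Real.log_natCast_nonneg (m ^ 2)
  have error_le := mleErrorLE_of_local_resistanceLE (a := 147648) (c := 9) (q := (r : ℝ) ^ 2)
    (X := Real.log (m ^ 2 : ℕ) / (r : ℝ) ^ 2 + 1) (by norm_num) (by norm_num) (sq_nonneg _)
    (le_add_of_nonneg_left (by positivity)) hκ hδ hδ1
    (by rw [card_eq]; exact_mod_cast card_orientedEdge_grid2D_le hr)
    (fun i j hij => (resistanceLE_grid2D_of_adj hr hrm hij).mono (by gcongr; norm_num))
    (resistanceLE_grid2D hr hrm) hstar hy
  simp only [card_eq] at error_le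
  exact error_le hcond

end Grids

end BTL

theorem corollary2_general :
    ∃ C₁ C₂ : ℝ, 0 < C₁ ∧ 0 < C₂ ∧
      (∀ (n r L : ℕ) (θstar : Fin n → ℝ) (κE δ : ℝ)
          (Ω : Type*) [MeasurableSpace Ω] (P : Measure Ω) [IsProbabilityMeasure P]
          (y : BTL.OrientedEdge (BTL.grid1D n r) → Fin L → Ω → ℝ),
        r ≤ n →
        1 ≤ κE →
        (∀ i j, (BTL.grid1D n r).Adj i j → |θstar i - θstar j| ≤ Real.log κE) →
        0 < δ → δ < 1 →
        BTL.IsSample P (BTL.grid1D n r) L θstar y →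
        C₁ * (κE ^ 4 * n * Real.log (n / δ)) ≤ (r : ℝ) * L →
        BTL.MLEErrorLE P (BTL.grid1D n r) y θstar δ fun _ _ =>
          C₂ * (κE * √(((n : ℝ) / (r : ℝ) ^ 2 + 1) * (1 / ((r : ℝ) * L)) *
            Real.log (n / δ)))) ∧
      (∀ (m r L : ℕ) (θstar : Fin m ×ₗ Fin m → ℝ) (κE δ : ℝ)
          (Ω : Type*) [MeasurableSpace Ω] (P : Measure Ω) [IsProbabilityMeasure P]
          (y : BTL.OrientedEdge (BTL.grid2D m r) → Fin L → Ω → ℝ),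
        r ≤ 2 * m →
        1 ≤ κE →
        (∀ i j, (BTL.grid2D m r).Adj i j → |θstar i - θstar j| ≤ Real.log κE) →
        0 < δ → δ < 1 →
        BTL.IsSample P (BTL.grid2D m r) L θstar y →
        C₁ * (κE ^ 4 * (m ^ 2 : ℕ) * Real.log ((m ^ 2 : ℕ) / δ)) ≤ (r : ℝ) ^ 2 * L →
        BTL.MLEErrorLE P (BTL.grid2D m r) y θstar δ fun _ _ =>
          C₂ * (κE * √((Real.log (m ^ 2 : ℕ) / (r : ℝ) ^ 2 + 1) * (1 / ((r : ℝ) ^ 2 * L)) *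
            Real.log ((m ^ 2 : ℕ) / δ)))) := by
  refine ⟨4096 * 147648 ^ 2 * 9, 8 * √147648, by norm_num, by positivity, ?_, ?_⟩
  · intro n r L θstar κE δ Ω _ P _ y hrn hκ hstar hδ hδ1 hy hcond
    have hcond' := (BTL.sampleBound_le_sampleBound (C := 4096 * 48 ^ 2 * 2) (by norm_num)
      (by norm_num) hκ le_rfl hδ hδ1).trans hcond
    exact (BTL.mleErrorLE_grid1D hrn hκ hstar hδ hδ1 hy hcond').mono fun _ _ => by
      gcongr
      norm_num
  · intro m r L θstar κE δ Ω _ P _ y hrm hκ hstar hδ hδ1 hy hcond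
    exact BTL.mleErrorLE_grid2D hrm hκ hstar hδ hδ1 hy hcond

theorem corollary2 :
    ∃ C₁ C₂ : ℝ, 0 < C₁ ∧ 0 < C₂ ∧
      -- one-dimensional grids
      (∀ (n r L : ℕ) (θstar : Fin n → ℝ) (κE δ : ℝ)
          (Ω : Type*) [MeasurableSpace Ω] (P : Measure Ω) [IsProbabilityMeasure P]
          (y : BTL.OrientedEdge (BTL.grid1D n r) → Fin L → Ω → ℝ),
        r ≤ n →
        ∑ i, θstar i = 0 →
        1 ≤ κE →
        (∀ i j, (BTL.grid1D n r).Adj i j → |θstar i - θstar j| ≤ Real.log κE) →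
        0 < δ → δ < 1 →
        BTL.IsSample P (BTL.grid1D n r) L θstar y →
        C₁ * (κE ^ 5 * n * Real.log (n / δ)) ≤ (r : ℝ) * L →
        ∃ A : Set Ω, MeasurableSet A ∧ ENNReal.ofReal (1 - δ) ≤ P A ∧ ∀ ω ∈ A,
          (∃! θ : Fin n → ℝ, BTL.IsMLE (BTL.grid1D n r) L (fun e l => y e l ω) θ) ∧
          ∀ θ : Fin n → ℝ, BTL.IsMLE (BTL.grid1D n r) L (fun e l => y e l ω) θ →
            ∀ k l : Fin n, |(θ k - θ l) - (θstar k - θstar l)| ≤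
              C₂ * (κE * √(((n : ℝ) / (r : ℝ) ^ 2 + 1) * (1 / ((r : ℝ) * L)) *
                Real.log (n / δ)))) ∧
      -- two-dimensional grids
      (∀ (n m r L : ℕ) (θstar : Fin m ×ₗ Fin m → ℝ) (κE δ : ℝ)
          (Ω : Type*) [MeasurableSpace Ω] (P : Measure Ω) [IsProbabilityMeasure P]
          (y : BTL.OrientedEdge (BTL.grid2D m r) → Fin L → Ω → ℝ),
        n = m ^ 2 →
        r ≤ 2 * m →
        ∑ i, θstar i = 0 →
        1 ≤ κE →
        (∀ i j, (BTL.grid2D m r).Adj i j → |θstar i - θstar j| ≤ Real.log κE) →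
        0 < δ → δ < 1 →
        BTL.IsSample P (BTL.grid2D m r) L θstar y →
        C₁ * (κE ^ 5 * n * Real.log (n / δ)) ≤ (r : ℝ) ^ 2 * L →
        ∃ A : Set Ω, MeasurableSet A ∧ ENNReal.ofReal (1 - δ) ≤ P A ∧ ∀ ω ∈ A,
          (∃! θ : Fin m ×ₗ Fin m → ℝ, BTL.IsMLE (BTL.grid2D m r) L (fun e l => y e l ω) θ) ∧
          ∀ θ : Fin m ×ₗ Fin m → ℝ, BTL.IsMLE (BTL.grid2D m r) L (fun e l => y e l ω) θ →
            ∀ k l : Fin m ×ₗ Fin m, |(θ k - θ l) - (θstar k - θstar l)| ≤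
              C₂ * (κE * √((Real.log n / (r : ℝ) ^ 2 + 1) * (1 / ((r : ℝ) ^ 2 * L)) *
                Real.log (n / δ)))) := by
  obtain ⟨C₁, C₂, hC₁, hC₂, error_le_grid1D, error_le_grid2D⟩ := corollary2_general
  refine ⟨C₁, C₂, hC₁, hC₂, ?_, ?_⟩
  · intro n r L θstar κE δ Ω _ P _ y hrn _ hκ hstar hδ hδ1 hy hcond
    exact error_le_grid1D n r L θstar κE δ Ω P y hrn hκ hstar hδ hδ1 hy
      ((BTL.sampleBound_le_sampleBound hC₁.le le_rfl hκ (by norm_num) hδ hδ1).trans hcond)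
  · rintro _ m r L θstar κE δ Ω _ P _ y rfl hrm _ hκ hstar hδ hδ1 hy hcond
    exact error_le_grid2D m r L θstar κE δ Ω P y hrm hκ hstar hδ hδ1 hy
      ((BTL.sampleBound_le_sampleBound hC₁.le le_rfl hκ (by norm_num) hδ hδ1).trans hcond)
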